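/- Identify the circle $T$ with $\mathbb R/\mathbb Z$. For an integer $d\ge 2$, a circle endomorphism $f$ of degree $d$ is an orientation-preserving covering map of $T$ of degree $d$ fixing the base point $0$; it is identified with its lift, an increasing homeomorphism $F:\mathbb R\to\mathbb R$ with $F(0)=0$ and $F(x+1)=F(x)+d$. An increasing homeomorphism $H$ of $\mathbb R$ with $H(x+1)=H(x)+1$ is the lift of a circle homeomorphism, which is called symmetric if there is a bounded function $\varepsilon(t)>0$ $(t>0)$ with $\varepsilon(t)\to0$ as $t\to0^+$ such that $$\frac1{1+\varepsilon(t)}\le\frac{|H(x+t)-H(x)|}{|H(x)-H(x-t)|}\le 1+\varepsilon(t)\qquad\text{for all }x\in\mathbb R,\ t>0;$$ $f$ is called uniformly symmetric if these inequalities hold for all $H=F^{-n}$, $n\ge1$, with one and the same $\varepsilon$. Let $\mathcal{TUS}_d$ be the set of equivalence classes $\tau$ of pairs $(f,h_f)$, where $f$ is a uniformly symmetric circle endomorphism of degree $d$ and $h_f$ is the orientation-preserving circle homeomorphism fixing the base point with $f\circ h_f=h_f\circ q_d$, $q_d(x)=dx$; two pairs $(f,h_f)$, $(g,h_g)$ are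 equivalent if $h_f\circ h_g^{-1}$ is symmetric. A probability measure $\mu$ on $T$ is symmetric if its distribution function $x\mapsto\mu([0,x])$ is a symmetric circle homeomorphism. Metric entropy means Kolmogorov--Sinai entropy (natural logarithm). The map $f$ is called $C^{1+\alpha}$ if $F$ is $C^1$ with $\alpha$-Hölder derivative, and expanding if $F$ is $C^1$ and there are $C>0$, $\lambda>1$ with $(F^n)'\ge C\lambda^n$ for all $n\ge1$. Let $\Sigma^*=\{w^*=\cdots j_2j_1j_0 : j_k\in\{0,\dots,d-1\}\}$ with the product topology, and let $\sigma^*(\cdots j_2j_1j_0)=\cdots j_2j_1$. For a finite word put $I_{j_{n-1}\cdots j_0}=G_{j_{n-1}}\circ\cdots\circ G_{j_0}([0,1])$ with $G_j(x)=F^{-1}(x+j)$. The dual derivative of $f$ is $$D^*(f)(w^*)=\lim_{n\to\infty}\frac{|I_{j_{n-1}\cdots j_1}|}{|I_{j_{n-1}\cdots j_1j_0}|},$$ and $\Psi^*=D^*(f)$, $f\in\tau$, is called the function model of $\tau\in\mathcal{TUS}_d$. For a positive continuous function $\Psi^*$ on $\Sigma^*$, a dual geometric Gibbs type measure for the potential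 $-\log\Psi^*$ is a non-atomic Borel probability measure $\mu^*$ on $\Sigma^*$ with full support such that $$\lim_{n\to\infty}\frac{\mu^*(\sigma^*[w_n^*])}{\mu^*([w_n^*])}=\Psi^*(w^*)\qquad\text{for all }w^*=\cdots j_1j_0\in\Sigma^*,$$ where $[w_n^*]$ is the set of all words in $\Sigma^*$ that end with $j_{n-1}\cdots j_0$. **Theorem.** (1) For every $d\ge2$, the infimum of the metric entropies $h_{\mu_{geo}}(f)$, over all $\tau\in\mathcal{TUS}_d$, all $f\in\tau$ and all symmetric $f$-invariant probability measures $\mu_{geo}$, is $0$. (2) For every $0<\alpha\le1$ there is a family $\{f_s\}_{0<s<1}$ of $C^{1+\alpha}$ expanding circle endomorphisms of degree $2$, each preserving the Lebesgue measure $Leb$ on $T$, such that $h_{Leb}(f_s)\to0$ as $s\to1^-$. (3) For every $d\ge2$, every dual geometric Gibbs type measure $\mu^*$ for $-\log\Psi^*$, where $\Psi^*$ is the function model of a point of $\mathcal{TUS}_d$, is $\sigma^*$-invariant. Over all such $\Psi^*$ and $\mu^*$, the maximum of the metric entropy $h_{\mu^*}(\sigma^*)$ is $\log d$ and its infimum is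 $0$. -/

import Mathlib

open Set Filter Topology MeasureTheory
open scoped ENNReal NNReal

noncomputable section

namespace CircleGibbs

/-! ### Kolmogorov-Sinai entropy -/

section Entropy

variable {X : Type*} [MeasurableSpace X]

/-- A finite measurable partition of `X` into `k` (possibly empty) pieces is given by its
labelling map `P : X → Fin k`. This is the Shannon entropy, with respect to `μ`, of the join of
the partitions `P, P ∘ T, …, P ∘ T^(n-1)`. -/
def joinEntropy (T : X → X) (μ : Measure X) {k : ℕ} (P : X → Fin k) (n : ℕ) : ℝ :=
  ∑ a : Fin n → Fin k, Real.negMulLog (μ.real {x | ∀ i : Fin n, P (T^[i] x) = a i})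

/-- The entropy of `T` relative to the partition `P`: the limit of `joinEntropy T μ P n / n`.
The limit exists when `μ` is a `T`-invariant probability measure. -/
def partitionEntropy (T : X → X) (μ : Measure X) {k : ℕ} (P : X → Fin k) : ℝ≥0∞ :=
  limsup (fun n : ℕ => ENNReal.ofReal (joinEntropy T μ P n / n)) atTop

/-- The metric (measure-theoretic, Kolmogorov-Sinai) entropy: the supremum of the entropies
relative to all finite measurable partitions. -/
def metricEntropy (T : X → X) (μ : Measure X) : ℝ≥0∞ :=
  ⨆ (k : ℕ) (P : X → Fin k) (_ : Measurable P), partitionEntropy T μ P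

end Entropy

/-! ### Circle maps and their lifts; the circle is `ℝ / ℤ` -/

/-- An orientation-preserving covering map of the circle of degree `d` fixing the base point,
given by its normalized lift: an increasing homeomorphism `F` of `ℝ` with
`F (x + 1) = F x + d` and `F 0 = 0`. -/
structure CircleEndo (d : ℕ) where
  /-- the lift -/
  lift : ℝ ≃o ℝ
  map_add_one : ∀ x, lift (x + 1) = lift x + d
  map_zero : lift 0 = 0

/-- An orientation-preserving homeomorphism of the circle, given by its normalized lift: an
increasing homeomorphism `H` of `ℝ` with `H (x + 1) = H x + 1` and `0 ≤ H 0 < 1`. -/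
structure CircleHomeo where
  /-- the lift -/
  lift : ℝ ≃o ℝ
  map_add_one : ∀ x, lift (x + 1) = lift x + 1
  map_zero_mem : lift 0 ∈ Ico (0 : ℝ) 1

theorem CircleEndo.periodic {d : ℕ} (f : CircleEndo d) :
    Function.Periodic (fun x : ℝ => (f.lift x : UnitAddCircle)) 1 := by
  intro x
  have h : ((d : ℝ) : UnitAddCircle) = 0 :=
    (AddCircle.coe_eq_zero_iff (1 : ℝ)).2 ⟨(d : ℤ), by simp⟩
  simp only [f.map_add_one, AddCircle.coe_add, h, add_zero]

theorem CircleHomeo.periodic (h : CircleHomeo) :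
    Function.Periodic (fun x : ℝ => (h.lift x : UnitAddCircle)) 1 := by
  intro x
  simp only [h.map_add_one, AddCircle.coe_add, AddCircle.coe_period, add_zero]

/-- The map of the circle `ℝ / ℤ` whose lift is `f.lift`. -/
def CircleEndo.toMap {d : ℕ} (f : CircleEndo d) : UnitAddCircle → UnitAddCircle :=
  f.periodic.lift

/-- The map of the circle `ℝ / ℤ` whose lift is `h.lift`. -/
def CircleHomeo.toMap (h : CircleHomeo) : UnitAddCircle → UnitAddCircle :=
  h.periodic.lift

/-- `f` is `C^{1+α}`: the lift is `C¹` and its derivative is `α`-Hölder continuous. -/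
def CircleEndo.IsC1Holder {d : ℕ} (f : CircleEndo d) (α : ℝ≥0) : Prop :=
  ContDiff ℝ 1 f.lift ∧ ∃ C : ℝ≥0, HolderWith C α (deriv f.lift)

/-- `f` (of class `C¹`) is expanding: `(Fⁿ)' ≥ C λⁿ` for all `n ≥ 1`, with `C > 0`, `λ > 1`. -/
def CircleEndo.IsExpanding {d : ℕ} (f : CircleEndo d) : Prop :=
  ContDiff ℝ 1 f.lift ∧
    ∃ C > (0 : ℝ), ∃ l > (1 : ℝ), ∀ n : ℕ, 1 ≤ n → ∀ x : ℝ, C * l ^ n ≤ deriv (f.lift^[n]) x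

/-! ### Symmetric homeomorphisms and uniformly symmetric endomorphisms -/

/-- `ε` is a positive bounded function on `t > 0` with `ε t → 0` as `t → 0+`. -/
def IsModulus (ε : ℝ → ℝ) : Prop :=
  (∀ t > 0, 0 < ε t) ∧ (∃ B, ∀ t > 0, ε t ≤ B) ∧ Tendsto ε (𝓝[>] 0) (𝓝 0)

/-- The symmetry ratios of `H : ℝ → ℝ` at scale `t` lie in `[1 / (1 + ε t), 1 + ε t]`. -/
def SymmetryBound (ε : ℝ → ℝ) (H : ℝ → ℝ) : Prop :=
  ∀ x t : ℝ, 0 < t →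
    1 / (1 + ε t) ≤ |H (x + t) - H x| / |H x - H (x - t)| ∧
      |H (x + t) - H x| / |H x - H (x - t)| ≤ 1 + ε t

/-- The (lift of a) circle homeomorphism `H` is symmetric. -/
def IsSymmetric (H : ℝ → ℝ) : Prop :=
  ∃ ε : ℝ → ℝ, IsModulus ε ∧ SymmetryBound ε H

/-- `f` is uniformly symmetric: one modulus serves all inverse iterates of the lift. -/
def CircleEndo.IsUniformlySymmetric {d : ℕ} (f : CircleEndo d) : Prop :=
  ∃ ε : ℝ → ℝ, IsModulus ε ∧ ∀ n : ℕ, 0 < n → SymmetryBound ε (f.lift.symm^[n])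

/-! ### The Teichmüller space of uniformly symmetric circle endomorphisms -/

/-- A marked uniformly symmetric circle endomorphism `(f, h)` of degree `d`: the marking `h` fixes
the base point and conjugates `z ↦ z ^ d` (here `z ↦ d • z` on `ℝ / ℤ`) to `f`. -/
structure MarkedEndo (d : ℕ) where
  /-- the endomorphism -/
  f : CircleEndo d
  uniformlySymmetric : f.IsUniformlySymmetric
  /-- the marking -/
  h : CircleHomeo
  h_zero : h.lift 0 = 0
  conj : ∀ z : UnitAddCircle, f.toMap (h.toMap z) = h.toMap (d • z)

/-- `(f, h_f)` and `(g, h_g)` are equivalent if `h_f ∘ h_g⁻¹` is symmetric. -/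
def MarkedEndo.Equivalent {d : ℕ} (p q : MarkedEndo d) : Prop :=
  IsSymmetric (fun x => p.h.lift (q.h.lift.symm x))

/-- The Teichmüller space of uniformly symmetric circle endomorphisms of degree `d`: the set of
all equivalence classes of marked endomorphisms. -/
def TUS (d : ℕ) : Set (Set (MarkedEndo d)) :=
  {τ | ∃ q : MarkedEndo d, τ = {p | p.Equivalent q}}

/-- A measure on the circle is symmetric if its distribution function `z ↦ μ [0, z]` is a
symmetric circle homeomorphism. -/
def IsSymmetricMeasure (μ : Measure UnitAddCircle) : Prop :=
  ∃ h : CircleHomeo, IsSymmetric h.lift ∧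
    ∀ x ∈ Ico (0 : ℝ) 1, h.lift x = μ.real ((fun y : ℝ => (y : UnitAddCircle)) '' Icc 0 x)

/-! ### The dual symbolic space -/

/-- The dual symbolic space: left-infinite words `⋯ j₂ j₁ j₀`, stored as `k ↦ j_k`, with the
product topology and its Borel sets. The right cylinder of the last `n` digits of `w` is
`PiNat.cylinder w n`. -/
abbrev DualSpace (d : ℕ) : Type := ℕ → Fin d

/-- The right shift `⋯ j₂ j₁ j₀ ↦ ⋯ j₂ j₁`. -/
def dualShift {d : ℕ} (w : DualSpace d) : DualSpace d := fun k => w (k + 1)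

/-- The inverse branch `G_{j_{n-1}} ∘ ⋯ ∘ G_{j_1} ∘ G_{j_0}` of the `n`-th iterate, where
`G_j x = F⁻¹ (x + j)`. -/
def CircleEndo.branch {d : ℕ} (f : CircleEndo d) (w : DualSpace d) : ℕ → ℝ → ℝ
  | 0, x => x
  | n + 1, x => f.lift.symm (f.branch w n x + (w n : ℕ))

/-- The length of the Markov interval of level `n`, contained in `[0, 1]`, that has the label
`j_{n-1} ⋯ j_1 j_0` (its first digit `j_{n-1}` says which interval of level one contains it): the
image of `[0, 1]` under the inverse branch of that label. -/
def CircleEndo.intervalLength {d : ℕ} (f : CircleEndo d) (w : DualSpace d) (n : ℕ) : ℝ :=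
  f.branch w n 1 - f.branch w n 0

/-- `Ψ` is the dual derivative of `f`: at `w = ⋯ j₁ j₀` it is the limit of the ratios of the
lengths of the intervals labelled `j_{n-1} ⋯ j_1` and `j_{n-1} ⋯ j_1 j_0`. -/
def CircleEndo.IsDualDerivative {d : ℕ} (f : CircleEndo d) (Ψ : DualSpace d → ℝ) : Prop :=
  ∀ w, Tendsto (fun n : ℕ => f.intervalLength (dualShift w) n / f.intervalLength w (n + 1))
    atTop (𝓝 (Ψ w))

/-- `Ψ` is the function model of the point `τ` of the Teichmüller space: the dual derivative of
the endomorphisms in `τ`. -/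
def IsFunctionModel {d : ℕ} (τ : Set (MarkedEndo d)) (Ψ : DualSpace d → ℝ) : Prop :=
  ∃ p ∈ τ, p.f.IsDualDerivative Ψ

/-- `μ` is a dual geometric Gibbs type measure for the potential `-log Ψ`, where `Ψ` is positive
and continuous: a non-atomic probability measure with full support such that the shift is
differentiable with derivative `Ψ` in the metric in which the distance of two points is the
measure of the smallest cylinder containing both. -/
structure IsDualGeometricGibbs {d : ℕ} (Ψ : DualSpace d → ℝ) (μ : Measure (DualSpace d)) :
    Prop where
  pos : ∀ w, 0 < Ψ w
  continuous : Continuous Ψ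
  isProbabilityMeasure : IsProbabilityMeasure μ
  noAtoms : ∀ w, μ {w} = 0
  fullSupport : μ.IsOpenPosMeasure
  deriv_eq : ∀ w, Tendsto
    (fun n : ℕ => μ.real (dualShift '' PiNat.cylinder w n) / μ.real (PiNat.cylinder w n))
    atTop (𝓝 (Ψ w))

/-! ### The sets of entropy values -/

/-- The metric entropies `h_μ(f)`, over all points `τ` of the Teichmüller space, all `f` in `τ`
and all symmetric `f`-invariant probability measures `μ`. -/
def geometricEntropies (d : ℕ) : Set ℝ≥0∞ :=
  {e | ∃ τ ∈ TUS d, ∃ p ∈ τ, ∃ μ : Measure UnitAddCircle, IsProbabilityMeasure μ ∧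
    IsSymmetricMeasure μ ∧ MeasurePreserving p.f.toMap μ μ ∧ e = metricEntropy p.f.toMap μ}

/-- The metric entropies of the dual shift, over all function models `Ψ` of points of the
Teichmüller space and all dual geometric Gibbs type measures for `-log Ψ`. -/
def dualEntropies (d : ℕ) : Set ℝ≥0∞ :=
  {e | ∃ τ ∈ TUS d, ∃ Ψ, IsFunctionModel τ Ψ ∧ ∃ μ : Measure (DualSpace d),
    IsDualGeometricGibbs Ψ μ ∧ e = metricEntropy dualShift μ}

end CircleGibbs

end

/-! Everything rests on one family of examples, one entropy bound and one differentiation argument.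

Examples. A map is described by its inverse lift `E` with derivative `ρ`. Lebesgue measure is
invariant when the translates `ρ (y + j)`, `0 ≤ j < d`, sum to 1. For `ρ y = S (y + 1) - S y` with
`S (y + d) = S y + 1` the sum telescopes. If `S` is strictly increasing and Lipschitz, then `ρ` is
Lipschitz with bounds strictly between 0 and 1, so the map is expanding, and bounded distortion
gives uniform symmetry. When `S` is nearly a step function, one Markov interval takes almost all the
length (`exists_inverseLift_long`).

Entropy. The Markov partition generates, so metric entropy is at most its Shannon entropy
(`metricEntropy_le_shannon`), which is small when one interval is long. On the dual side the last
digit plays the same role and gives the upper bound `log d`.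

Invariance. The intervals labelled `wj` tile the one labelled `w`, so `∑ j, 1 / Ψ(wj) = 1`. Hence,
for a dual Gibbs measure, the ratio of the pushforward under the shift to the measure tends to 1
along the cylinders around every point, and this forces equality. In the examples the interval
lengths are themselves the cylinder masses of a dual Gibbs measure; the linear map gives the uniform
Bernoulli measure, of entropy `log d`, and the long-interval maps give entropies tending to 0. -/

noncomputable section

namespace CircleGibbs

/-! ### Shannon entropy of finite-valued random variables -/

section Shannon

variable {Ω : Type*} [MeasurableSpace Ω] {α β : Type*} [Fintype α]

/-- The Shannon entropy of a finite-valued random variable. -/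
def shannon (μ : Measure Ω) (X : Ω → α) : ℝ := ∑ a, Real.negMulLog (μ.real (X ⁻¹' {a}))

/-- Since `-log` is decreasing, `-log (∑ p)` is at most each `-log (p i)`. Thus merging atoms cannot
raise entropy. -/
theorem negMulLog_sum_le {ι : Type*} (s : Finset ι) (p : ι → ℝ) (hp : ∀ i, 0 ≤ p i) :
    Real.negMulLog (∑ i ∈ s, p i) ≤ ∑ i ∈ s, Real.negMulLog (p i) := by
  rw [Real.negMulLog, neg_mul, Finset.sum_mul, ← Finset.sum_neg_distrib]
  refine Finset.sum_le_sum fun i hi => ?_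
  rw [Real.negMulLog, neg_mul, neg_le_neg_iff]
  rcases (hp i).eq_or_lt with h | h
  · simp [← h]
  · exact mul_le_mul_of_nonneg_left
      (Real.log_le_log h (Finset.single_le_sum (fun j _ => hp j) hi)) (hp i)

theorem measureReal_preimage_comp (μ : Measure Ω) [IsFiniteMeasure μ] [DecidableEq β] {X : Ω → α}
    (hX : ∀ a, MeasurableSet (X ⁻¹' {a})) (g : α → β) (b : β) :
    μ.real ((g ∘ X) ⁻¹' {b}) = ∑ a with g a = b, μ.real (X ⁻¹' {a}) := by
  rw [← measureReal_biUnion_finset _ (fun a _ => hX a)]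
  · congr 1
    ext x
    simp
  · intro a _ a' _ h
    exact Disjoint.preimage _ (by simpa using h)

theorem shannon_comp_le [Fintype β] (μ : Measure Ω) [IsFiniteMeasure μ] {X : Ω → α}
    (hX : ∀ a, MeasurableSet (X ⁻¹' {a})) (g : α → β) :
    shannon μ (g ∘ X) ≤ shannon μ X := by
  classical
  unfold shannon
  rw [← Finset.sum_fiberwise (s := Finset.univ) (g := g)]
  refine Finset.sum_le_sum fun b _ => ?_
  rw [measureReal_preimage_comp μ hX g b]
  exact negMulLog_sum_le _ _ fun _ => measureReal_nonneg

/-- This is `log t ≤ t - 1` at `t = q r / p`, multiplied by `p`. For a joint law `p` with marginals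
`q` and `r` the corrections `q r - p` sum to zero, which yields subadditivity of entropy. -/
theorem negMulLog_le_cross {p q r : ℝ} (hp : 0 ≤ p) (hq : p ≤ q) (hr : p ≤ r) :
    Real.negMulLog p ≤ -(p * Real.log q) - p * Real.log r + (q * r - p) := by
  rcases hp.eq_or_lt with h | h
  · subst h
    simpa using mul_nonneg hq hr
  · have hq' := h.trans_le hq
    have hr' := h.trans_le hr
    have key := Real.log_le_sub_one_of_pos (show 0 < q * r / p by positivity)
    rw [Real.log_div (by positivity) h.ne', Real.log_mul hq'.ne' hr'.ne'] at key
    have := mul_le_mul_of_nonneg_left key hp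
    rw [mul_sub, mul_sub, mul_div_cancel₀ _ h.ne'] at this
    rw [Real.negMulLog]
    linarith

theorem sum_measureReal_inter (μ : Measure Ω) [IsFiniteMeasure μ] {Y : Ω → α}
    (hY : ∀ b, MeasurableSet (Y ⁻¹' {b})) (A : Set Ω) :
    ∑ b, μ.real (A ∩ Y ⁻¹' {b}) = μ.real A := by
  classical
  have := measureReal_preimage_comp (μ.restrict A) hY (fun _ => ()) ()
  simp only [Finset.filter_true] at this
  have h2 : ((fun _ => ()) ∘ Y) ⁻¹' {()} = (univ : Set Ω) := by ext; simp
  rw [h2] at this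
  simp only [measureReal_restrict_apply (hY _), measureReal_restrict_apply MeasurableSet.univ,
    univ_inter] at this
  rw [this]
  exact Finset.sum_congr rfl fun b _ => by rw [inter_comm]

theorem shannon_prod_le [Fintype β] (μ : Measure Ω) [IsProbabilityMeasure μ] {X : Ω → α} {Y : Ω → β}
    (hX : ∀ a, MeasurableSet (X ⁻¹' {a})) (hY : ∀ b, MeasurableSet (Y ⁻¹' {b})) :
    shannon μ (fun x => (X x, Y x)) ≤ shannon μ X + shannon μ Y := by
  have hpre : ∀ a b, (fun x => (X x, Y x)) ⁻¹' {(a, b)} = X ⁻¹' {a} ∩ Y ⁻¹' {b} := by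
    intro a b
    ext x
    simp
  have hsX : ∑ a, μ.real (X ⁻¹' {a}) = 1 := by simpa using sum_measureReal_inter μ hX univ
  have hsY : ∑ b, μ.real (Y ⁻¹' {b}) = 1 := by simpa using sum_measureReal_inter μ hY univ
  have hb : ∀ a, ∑ b, μ.real (X ⁻¹' {a} ∩ Y ⁻¹' {b}) = μ.real (X ⁻¹' {a}) :=
    fun a => sum_measureReal_inter μ hY _
  have ha : ∀ b, ∑ a, μ.real (X ⁻¹' {a} ∩ Y ⁻¹' {b}) = μ.real (Y ⁻¹' {b}) := fun b => by
    simpa only [inter_comm] using sum_measureReal_inter μ hX (Y ⁻¹' {b})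
  unfold shannon
  rw [Fintype.sum_prod_type]
  simp only [hpre]
  calc ∑ a, ∑ b, Real.negMulLog (μ.real (X ⁻¹' {a} ∩ Y ⁻¹' {b}))
      ≤ ∑ a, ∑ b, (-(μ.real (X ⁻¹' {a} ∩ Y ⁻¹' {b}) * Real.log (μ.real (X ⁻¹' {a})))
          - μ.real (X ⁻¹' {a} ∩ Y ⁻¹' {b}) * Real.log (μ.real (Y ⁻¹' {b}))
          + (μ.real (X ⁻¹' {a}) * μ.real (Y ⁻¹' {b}) - μ.real (X ⁻¹' {a} ∩ Y ⁻¹' {b}))) :=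
        Finset.sum_le_sum fun a _ => Finset.sum_le_sum fun b _ =>
          negMulLog_le_cross measureReal_nonneg (measureReal_mono inter_subset_left)
            (measureReal_mono inter_subset_right)
    _ = _ := by
        simp only [Finset.sum_add_distrib, Finset.sum_sub_distrib, Finset.sum_neg_distrib,
          ← Finset.sum_mul, ← Finset.mul_sum, hb, hsX, hsY]
        rw [Finset.sum_comm (f := fun a b =>
          μ.real (X ⁻¹' {a} ∩ Y ⁻¹' {b}) * Real.log (μ.real (Y ⁻¹' {b})))]
        simp only [← Finset.sum_mul, ha, Real.negMulLog, neg_mul, Finset.sum_neg_distrib]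
        ring

/-- The entropy of a nearly deterministic variable is small. -/
theorem exists_delta_entropy_lt (a₀ : α) {ε : ℝ} (hε : 0 < ε) :
    ∃ δ > 0, ∀ p : α → ℝ, (∀ a, 0 ≤ p a) → ∑ a, p a = 1 → 1 - δ ≤ p a₀ →
      ∑ a, Real.negMulLog (p a) < ε := by
  classical
  -- Entropy is continuous in the probability vector and vanishes at a vertex of the simplex.
  have hc : Continuous fun p : α → ℝ => ∑ a, Real.negMulLog (p a) :=
    continuous_finsetSum _ fun a _ => Real.continuous_negMulLog.comp (continuous_apply a)
  have h0 : ∑ a, Real.negMulLog ((Pi.single a₀ 1 : α → ℝ) a) = 0 := by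
    refine Finset.sum_eq_zero fun a _ => ?_
    by_cases h : a = a₀
    · subst h; simp
    · simp [h]
  obtain ⟨δ, hδ, H⟩ := Metric.continuous_iff.1 hc (Pi.single a₀ 1) ε hε
  refine ⟨δ / 2, by positivity, fun p hp hs h1 => ?_⟩
  have hle : ∀ a, a ≠ a₀ → p a ≤ 1 - p a₀ := by
    intro a ha
    rw [← hs, le_sub_iff_add_le, ← Finset.sum_pair ha]
    exact Finset.sum_le_sum_of_subset_of_nonneg (Finset.subset_univ _) fun i _ _ => hp i
  have h1' : p a₀ ≤ 1 := by
    rw [← hs]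
    exact Finset.single_le_sum (fun i _ => hp i) (Finset.mem_univ _)
  have := H p ?_
  · rw [h0, Real.dist_eq, sub_zero] at this
    exact (le_abs_self _).trans_lt this
  · rw [dist_pi_lt_iff hδ]
    intro a
    rw [Real.dist_eq]
    by_cases h : a = a₀
    · subst h
      rw [Pi.single_eq_same, abs_lt]
      constructor <;> linarith
    · rw [Pi.single_eq_of_ne h, sub_zero, abs_of_nonneg (hp a)]
      have := hle a h
      linarith

theorem shannon_lt_of_concentrated (a₀ : α) {ε : ℝ} (hε : 0 < ε) :
    ∃ δ > 0, ∀ (μ : Measure Ω) [IsProbabilityMeasure μ] (X : Ω → α),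
      (∀ a, MeasurableSet (X ⁻¹' {a})) → 1 - δ ≤ μ.real (X ⁻¹' {a₀}) → shannon μ X < ε := by
  obtain ⟨δ, hδ, H⟩ := exists_delta_entropy_lt a₀ hε
  refine ⟨δ, hδ, fun μ _ X hX h => H _ (fun _ => measureReal_nonneg) ?_ h⟩
  simpa using sum_measureReal_inter μ hX univ

theorem shannon_le_log_card (μ : Measure Ω) [IsProbabilityMeasure μ] {X : Ω → α}
    (hX : ∀ a, MeasurableSet (X ⁻¹' {a})) : shannon μ X ≤ Real.log (Fintype.card α) := by
  have hs : ∑ a, μ.real (X ⁻¹' {a}) = 1 := by simpa using sum_measureReal_inter μ hX univ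
  have hne : Nonempty α := by
    by_contra h
    rw [not_nonempty_iff] at h
    simp at hs
  have hc : (0 : ℝ) < Fintype.card α := by exact_mod_cast Fintype.card_pos
  have key : ∀ p : ℝ, 0 ≤ p →
      Real.negMulLog p ≤ p * Real.log (Fintype.card α) + ((Fintype.card α : ℝ)⁻¹ - p) := by
    intro p hp
    rcases hp.eq_or_lt with h | h
    · subst h
      simp
    · have := Real.log_le_sub_one_of_pos (show 0 < (Fintype.card α : ℝ)⁻¹ / p by positivity)
      rw [Real.log_div (by positivity) h.ne', Real.log_inv] at this
      have := mul_le_mul_of_nonneg_left this hp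
      rw [mul_sub, mul_sub, mul_div_cancel₀ _ h.ne'] at this
      rw [Real.negMulLog]
      linarith
  calc shannon μ X ≤ ∑ a, (μ.real (X ⁻¹' {a}) * Real.log (Fintype.card α)
        + ((Fintype.card α : ℝ)⁻¹ - μ.real (X ⁻¹' {a}))) :=
        Finset.sum_le_sum fun a _ => key _ measureReal_nonneg
    _ = _ := by
      rw [Finset.sum_add_distrib, ← Finset.sum_mul, Finset.sum_sub_distrib, hs]
      simp [hc.ne']

end Shannon

/-! ### The entropy of a transformation with a generating partition -/

section Generator

variable {X : Type*} [MeasurableSpace X]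

/-- The first `n` labels along the orbit. -/
def itin {Y α : Type*} (T : Y → Y) (P : Y → α) (n : ℕ) (x : Y) : Fin n → α := fun i => P (T^[i] x)

theorem joinEntropy_eq_shannon (T : X → X) (μ : Measure X) {k : ℕ} (P : X → Fin k) (n : ℕ) :
    joinEntropy T μ P n = shannon μ (itin T P n) := by
  refine Finset.sum_congr rfl fun a _ => ?_
  congr 2
  ext x
  simp [itin, funext_iff]

theorem measurableSet_fiber_of_measurable {α : Type*} [MeasurableSpace α]
    [MeasurableSingletonClass α] {P : X → α} (hP : Measurable P) (a : α) :
    MeasurableSet (P ⁻¹' {a}) := hP (measurableSet_singleton a)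

theorem measurable_itin {T : X → X} (hT : Measurable T) {α : Type*} [MeasurableSpace α]
    {P : X → α} (hP : Measurable P) (n : ℕ) : Measurable (itin T P n) :=
  measurable_pi_lambda _ fun i => hP.comp (hT.iterate i)

theorem shannon_comp_measurePreserving {T : X → X} {μ : Measure X} (hT : MeasurePreserving T μ μ)
    {α : Type*} [Fintype α] {P : X → α} (hP : ∀ a, MeasurableSet (P ⁻¹' {a})) :
    shannon μ (P ∘ T) = shannon μ P := by
  unfold shannon
  refine Finset.sum_congr rfl fun a _ => ?_
  rw [preimage_comp, measureReal_def, measureReal_def,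
    hT.measure_preimage (hP a).nullMeasurableSet]

/-- Subadditivity over the `n` times, each contributing the same entropy by invariance. -/
theorem shannon_itin_le {T : X → X} {μ : Measure X} [IsProbabilityMeasure μ]
    (hT : MeasurePreserving T μ μ) {k : ℕ} {P : X → Fin k} (hP : Measurable P) (n : ℕ) :
    shannon μ (itin T P n) ≤ n * shannon μ P := by
  induction n with
  | zero =>
    refine (shannon_le_log_card μ
      (measurableSet_fiber_of_measurable (measurable_itin hT.measurable hP 0))).trans ?_
    simp
  | succ n ih =>
    have h : itin T P (n + 1) =
        (fun q : (Fin n → Fin k) × Fin k => Fin.snoc (α := fun _ => Fin k) q.1 q.2) ∘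
          fun x => (itin T P n x, (P ∘ T^[n]) x) := by
      funext x i
      refine Fin.lastCases ?_ (fun i => ?_) i <;> simp [itin]
    have hn := hT.iterate n
    rw [h]
    refine (shannon_comp_le μ (measurableSet_fiber_of_measurable
      ((measurable_itin hT.measurable hP n).prodMk (hP.comp hn.measurable))) _).trans ?_
    refine (shannon_prod_le μ
      (measurableSet_fiber_of_measurable (measurable_itin hT.measurable hP n))
      (measurableSet_fiber_of_measurable (hP.comp hn.measurable))).trans ?_
    rw [shannon_comp_measurePreserving hn (measurableSet_fiber_of_measurable hP)]
    push_cast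
    linarith

theorem isSetAlgebra_itin {Y α : Type*} (T : Y → Y) (P : Y → α) :
    IsSetAlgebra {A : Set Y | ∃ n, ∃ S : Set (Fin n → α), A = itin T P n ⁻¹' S} where
  empty_mem := ⟨0, ∅, rfl⟩
  compl_mem := by
    rintro _ ⟨n, S, rfl⟩
    exact ⟨n, Sᶜ, rfl⟩
  union_mem := by
    rintro _ _ ⟨n, S, rfl⟩ ⟨m, S', rfl⟩
    exact ⟨max n m, {v | (fun i : Fin n => v (i.castLE (le_max_left n m))) ∈ S ∨
      (fun i : Fin m => v (i.castLE (le_max_right n m))) ∈ S'}, rfl⟩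

/-- The coding by itineraries is an injective Borel map on a standard Borel space, hence a
measurable embedding (Lusin–Souslin), so the σ-algebra is pulled back from the product. -/
theorem generateFrom_itin [StandardBorelSpace X] {T : X → X} (hT : Measurable T) {l : ℕ}
    {P : X → Fin l} (hP : Measurable P) (hinj : Function.Injective fun x (n : ℕ) => P (T^[n] x)) :
    (inferInstance : MeasurableSpace X) = MeasurableSpace.generateFrom
      {A : Set X | ∃ n, ∃ S : Set (Fin n → Fin l), A = itin T P n ⁻¹' S} := by
  have hm : Measurable fun x (n : ℕ) => P (T^[n] x) :=
    measurable_pi_lambda _ fun n => hP.comp (hT.iterate n)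
  apply le_antisymm
  · rw [← (hm.measurableEmbedding hinj).comap_eq, MeasurableSpace.pi, MeasurableSpace.comap_iSup]
    refine iSup_le fun n => ?_
    rw [MeasurableSpace.comap_comp]
    rintro _ ⟨S, -, rfl⟩
    exact MeasurableSpace.measurableSet_generateFrom
      ⟨n + 1, {v | v (Fin.last n) ∈ S}, rfl⟩
  · refine MeasurableSpace.generateFrom_le ?_
    rintro _ ⟨n, S, rfl⟩
    exact measurable_itin hT hP n S.toFinite.measurableSet

/-- A partition is approximated by functions of a finite itinerary of a generating partition. -/
theorem exists_approx_itin [StandardBorelSpace X] {T : X → X} {μ : Measure X}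
    [IsProbabilityMeasure μ] (hT : Measurable T) {l : ℕ} {P : X → Fin l} (hP : Measurable P)
    (hinj : Function.Injective fun x (n : ℕ) => P (T^[n] x)) {k : ℕ} {Q : X → Fin k}
    (hQ : Measurable Q) {δ : ℝ} (hδ : 0 < δ) :
    ∃ m, ∃ g : (Fin m → Fin l) → Fin k, μ.real {x | Q x ≠ g (itin T P m x)} ≤ δ := by
  classical
  have hd := Measure.MeasureDense.of_generateFrom_isSetAlgebra_finite (μ := μ)
    (isSetAlgebra_itin T P) (generateFrom_itin hT hP hinj)
  have hne : Nonempty X := (IsProbabilityMeasure.neZero μ).out |> fun h => by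
    by_contra hX
    rw [not_nonempty_iff] at hX
    exact h (Measure.eq_zero_of_isEmpty μ)
  obtain ⟨x₀⟩ := hne
  have hk : 0 < k := (Q x₀).pos
  have happ : ∀ i : Fin k, ∃ n, ∃ S : Set (Fin n → Fin l),
      μ.real (symmDiff (Q ⁻¹' {i}) (itin T P n ⁻¹' S)) ≤ δ / k := by
    intro i
    obtain ⟨_, ⟨n, S, rfl⟩, h⟩ := hd.approx (Q ⁻¹' {i})
      (measurableSet_fiber_of_measurable hQ i) (measure_ne_top _ _) (δ / k) (by positivity)
    refine ⟨n, S, ?_⟩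
    rw [measureReal_def]
    exact ENNReal.toReal_le_of_le_ofReal (by positivity) h.le
  choose N S hS using happ
  set m := Finset.univ.sup N
  have hN : ∀ i, N i ≤ m := fun i => Finset.le_sup (f := N) (Finset.mem_univ i)
  let S' : Fin k → Set (Fin m → Fin l) := fun i => {v | (fun j => v (Fin.castLE (hN i) j)) ∈ S i}
  -- Decode `v` as any `i` whose approximating set contains it; `Q x₀` is a mere default. Off the
  -- symmetric differences the only such `i` is `Q x`.
  refine ⟨m, fun v => if h : ∃ i, v ∈ S' i then h.choose else Q x₀, ?_⟩
  have hsub : {x | Q x ≠ if h : ∃ i, itin T P m x ∈ S' i then h.choose else Q x₀} ⊆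
      ⋃ i ∈ (Finset.univ : Finset (Fin k)), symmDiff (Q ⁻¹' {i}) (itin T P (N i) ⁻¹' S i) := by
    intro x hx
    by_contra hno
    simp only [Finset.mem_univ, iUnion_true, mem_iUnion, not_exists, mem_symmDiff, mem_preimage,
      mem_singleton_iff, not_or, not_and, not_not] at hno
    have hex : ∃ i, itin T P m x ∈ S' i := ⟨Q x, (hno (Q x)).1 rfl⟩
    refine hx ?_
    rw [dif_pos hex]
    exact (hno _).2 hex.choose_spec
  refine (measureReal_mono hsub (measure_ne_top _ _)).trans ((measureReal_biUnion_finset_le _ _).trans ?_)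
  refine (Finset.sum_le_sum fun i _ => hS i).trans ?_
  have : (k : ℝ) ≠ 0 := by positivity
  simp [mul_div_cancel₀ _ this]

/-- `D` corrects the guess `g`: 0 accepts it, `i.succ` replaces it by `i`. So `n` labels of `Q` are
a function of `n` labels of `D` and `n + m` labels of `P`, the extra `m` because `g` looks ahead. -/
theorem shannon_itin_le_of_approx {T : X → X} {μ : Measure X} [IsProbabilityMeasure μ]
    (hT : MeasurePreserving T μ μ) {l k m : ℕ} {P : X → Fin l} (hP : Measurable P)
    {Q : X → Fin k} (D : X → Fin (k + 1)) (hD : Measurable D) (g : (Fin m → Fin l) → Fin k)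
    (hQ : ∀ x, Q x = Fin.cases (g (itin T P m x)) id (D x)) (n : ℕ) :
    shannon μ (itin T Q n) ≤ (n + m) * shannon μ P + n * shannon μ D := by
  have h : itin T Q n =
      (fun q : (Fin (n + m) → Fin l) × (Fin n → Fin (k + 1)) => fun i : Fin n =>
        (Fin.cases (g fun j => q.1 ⟨i + j, by omega⟩) id (q.2 i) : Fin k)) ∘
          fun x => (itin T P (n + m) x, itin T D n x) := by
    funext x i
    simp only [itin, Function.comp, hQ]
    congr! 3 with j
    rw [itin, ← Function.iterate_add_apply, add_comm]
  have hmP := measurable_itin hT.measurable hP (n + m)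
  have hmD := measurable_itin hT.measurable hD n
  rw [h]
  refine (shannon_comp_le μ (measurableSet_fiber_of_measurable (hmP.prodMk hmD)) _).trans ?_
  refine (shannon_prod_le μ (measurableSet_fiber_of_measurable hmP)
    (measurableSet_fiber_of_measurable hmD)).trans ?_
  have h1 := shannon_itin_le hT hP (n + m)
  have h2 := shannon_itin_le hT hD n
  push_cast at h1
  linarith

/-- The metric entropy is bounded by the Shannon entropy of a generating partition. -/
theorem metricEntropy_le_shannon [StandardBorelSpace X] {T : X → X} {μ : Measure X}
    [IsProbabilityMeasure μ] (hT : MeasurePreserving T μ μ) {l : ℕ} {P : X → Fin l}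
    (hP : Measurable P) (hinj : Function.Injective fun x (n : ℕ) => P (T^[n] x)) :
    metricEntropy T μ ≤ ENNReal.ofReal (shannon μ P) := by
  refine iSup_le fun k => iSup_le fun Q => iSup_le fun hQ => ?_
  have key : ∀ ε > (0 : ℝ), partitionEntropy T μ Q ≤ ENNReal.ofReal (shannon μ P + ε) := by
    intro ε hε
    obtain ⟨δ, hδ, hH⟩ := shannon_lt_of_concentrated (Ω := X) (0 : Fin (k + 1)) hε
    obtain ⟨m, g, hg⟩ := exists_approx_itin (μ := μ) hT.measurable hP hinj hQ hδ
    have hgm : Measurable fun x => g (itin T P m x) :=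
      (measurable_of_finite g).comp (measurable_itin hT.measurable hP m)
    have hset : MeasurableSet {x | Q x = g (itin T P m x)} := measurableSet_eq_fun hQ hgm
    -- The correction variable is 0 off a set of measure at most `δ`, so its entropy is below `ε`.
    let D : X → Fin (k + 1) := fun x => if Q x = g (itin T P m x) then 0 else (Q x).succ
    have hD : Measurable D :=
      Measurable.ite hset measurable_const ((measurable_of_finite Fin.succ).comp hQ)
    have hQD : ∀ x, Q x = Fin.cases (g (itin T P m x)) id (D x) := by
      intro x
      by_cases h : Q x = g (itin T P m x) <;> simp [D, h]
    have hDs : shannon μ D < ε := by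
      refine hH μ D (measurableSet_fiber_of_measurable hD) ?_
      have : D ⁻¹' {0} = {x | Q x ≠ g (itin T P m x)}ᶜ := by
        ext x
        by_cases h : Q x = g (itin T P m x) <;> simp [D, h]
      have hc := probReal_compl_eq_one_sub (μ := μ) (s := {x | Q x ≠ g (itin T P m x)}) hset.compl
      rw [this, hc]
      linarith
    have hb : ∀ n : ℕ, 0 < n → joinEntropy T μ Q n / n ≤
        (1 + m / n) * shannon μ P + ε := by
      intro n hn
      have hn' : (0 : ℝ) < n := by exact_mod_cast hn
      rw [joinEntropy_eq_shannon, div_le_iff₀ hn']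
      refine (shannon_itin_le_of_approx hT hP D hD g hQD n).trans ?_
      have := mul_le_mul_of_nonneg_left hDs.le hn'.le
      have e : ((1 + (m : ℝ) / n) * shannon μ P + ε) * n
          = (n + m) * shannon μ P + n * ε := by field_simp
      linarith
    have hlim : Tendsto (fun n : ℕ => ENNReal.ofReal ((1 + (m : ℝ) / n) * shannon μ P + ε)) atTop
        (𝓝 (ENNReal.ofReal (shannon μ P + ε))) := by
      refine (ENNReal.continuous_ofReal.tendsto _).comp ?_
      have := ((tendsto_const_div_atTop_nhds_zero_nat (m : ℝ)).const_add 1).mul_const (shannon μ P)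
      simpa using this.add_const ε
    rw [partitionEntropy, ← hlim.limsup_eq]
    refine limsup_le_limsup ?_
    filter_upwards [eventually_gt_atTop 0] with n hn
    exact ENNReal.ofReal_le_ofReal (hb n hn)
  have hlim : Tendsto (fun ε : ℝ => ENNReal.ofReal (shannon μ P + ε)) (𝓝[>] 0)
      (𝓝 (ENNReal.ofReal (shannon μ P))) := by
    refine tendsto_nhdsWithin_of_tendsto_nhds ?_
    have : Continuous fun ε : ℝ => ENNReal.ofReal (shannon μ P + ε) :=
      ENNReal.continuous_ofReal.comp (continuous_const.add continuous_id)
    simpa using this.tendsto 0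
  exact ge_of_tendsto hlim (eventually_mem_nhdsWithin.mono fun ε hε => key ε hε)

end Generator

/-! ### Contracting inverse lifts of Lebesgue-preserving endomorphisms -/

/-- The inverse `E` of the lift of a smooth expanding circle endomorphism of degree `d` which
preserves the Lebesgue measure, together with its derivative `ρ`. -/
structure InverseLift (d : ℕ) where
  /-- the inverse lift -/
  E : ℝ → ℝ
  /-- its derivative -/
  ρ : ℝ → ℝ
  /-- a lower bound of the derivative -/
  c : ℝ
  /-- an upper bound of the derivative -/
  l : ℝ
  /-- a Lipschitz constant of the derivative -/
  K : ℝ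
  hasDerivAt : ∀ x, HasDerivAt E (ρ x) x
  c_pos : 0 < c
  c_le : ∀ x, c ≤ ρ x
  le_l : ∀ x, ρ x ≤ l
  l_lt_one : l < 1
  lipschitz : ∀ x y, |ρ x - ρ y| ≤ K * |x - y|
  map_zero : E 0 = 0
  -- Invariance of Lebesgue measure: the `d` preimages of `[0, x]` have total length `x`. This also
  -- forces `E (x + d) = E x + 1`.
  sum_eq : ∀ x, ∑ j ∈ Finset.range d, (E (x + j) - E j) = x

/-- The inverse lift of multiplication by `d`. -/
def InverseLift.linear (d : ℕ) (hd : 2 ≤ d) : InverseLift d where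
  E x := x / d
  ρ _ := 1 / d
  c := 1 / d
  l := 1 / d
  K := 0
  hasDerivAt x := (hasDerivAt_id x).div_const _
  c_pos := by positivity
  c_le _ := le_rfl
  le_l _ := le_rfl
  l_lt_one := by
    have : (2 : ℝ) ≤ d := by exact_mod_cast hd
    rw [div_lt_one (by linarith)]
    linarith
  lipschitz x y := by simp
  map_zero := by simp
  sum_eq x := by
    have : (d : ℝ) ≠ 0 := by positivity
    simp only [← sub_div, add_sub_cancel_right, Finset.sum_const, Finset.card_range,
      nsmul_eq_mul]
    field_simp

/-- An increasing Lipschitz function with `S (y + d) = S y + 1`. -/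
structure Staircase (d : ℕ) where
  /-- the function -/
  S : ℝ → ℝ
  /-- a Lipschitz constant -/
  K : ℝ≥0
  strictMono : StrictMono S
  lipschitz : LipschitzWith K S
  add_period : ∀ y, S (y + d) = S y + 1

/-! ### Lebesgue-preserving inverse lifts from staircase functions -/

namespace Staircase

variable {d : ℕ} (s : Staircase d)

/-- The density `S (y + 1) - S y`. -/
def density (y : ℝ) : ℝ := s.S (y + 1) - s.S y

theorem continuous_density : Continuous s.density :=
  (s.lipschitz.continuous.comp (continuous_add_const 1)).sub s.lipschitz.continuous

theorem density_pos (y : ℝ) : 0 < s.density y := sub_pos.2 (s.strictMono (by linarith))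

/-- As `d ≥ 2`, a unit window is strictly shorter than a period, over which `S` gains 1. -/
theorem density_lt_one (hd : 2 ≤ d) (y : ℝ) : s.density y < 1 := by
  have : (2 : ℝ) ≤ d := by exact_mod_cast hd
  have h := s.strictMono (show y + 1 < y + d by linarith)
  rw [s.add_period] at h
  rw [density]
  linarith

theorem density_periodic : Function.Periodic s.density d := by
  intro y
  rw [density, density, add_right_comm, s.add_period, s.add_period]
  ring

/-- The unit windows tile one period, so the increments telescope. -/
theorem sum_density (y : ℝ) : ∑ j ∈ Finset.range d, s.density (y + j) = 1 := by
  have := Finset.sum_range_sub (fun j : ℕ => s.S (y + j)) d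
  simp only [Nat.cast_add, Nat.cast_one, ← add_assoc, s.add_period, Nat.cast_zero, add_zero,
    add_sub_cancel_left] at this
  exact this

theorem exists_density_bounds (hd : 2 ≤ d) :
    ∃ c l : ℝ, 0 < c ∧ l < 1 ∧ ∀ y, c ≤ s.density y ∧ s.density y ≤ l := by
  have hd0 : (0 : ℝ) < d := by positivity
  have hne : (Icc (0 : ℝ) d).Nonempty := ⟨0, by simp⟩
  obtain ⟨a, -, ha⟩ := isCompact_Icc.exists_isMinOn hne s.continuous_density.continuousOn
  obtain ⟨b, -, hb⟩ := isCompact_Icc.exists_isMaxOn hne s.continuous_density.continuousOn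
  refine ⟨_, _, s.density_pos a, s.density_lt_one hd b, fun y => ?_⟩
  obtain ⟨z, hz, hyz⟩ := s.density_periodic.exists_mem_Ico₀ hd0 y
  rw [hyz]
  exact ⟨ha (Ico_subset_Icc_self hz), hb (Ico_subset_Icc_self hz)⟩

theorem intervalIntegrable_density (a b : ℝ) : IntervalIntegrable s.density volume a b :=
  s.continuous_density.intervalIntegrable a b

/-- The inverse lift with derivative `S (y + 1) - S y`. -/
def inverseLift (hd : 2 ≤ d) : InverseLift d where
  E x := ∫ y in 0..x, s.density y
  ρ := s.density
  c := (s.exists_density_bounds hd).choose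
  l := (s.exists_density_bounds hd).choose_spec.choose
  K := 2 * s.K
  hasDerivAt x := s.continuous_density.integral_hasStrictDerivAt 0 x |>.hasDerivAt
  c_pos := (s.exists_density_bounds hd).choose_spec.choose_spec.1
  c_le x := ((s.exists_density_bounds hd).choose_spec.choose_spec.2.2 x).1
  le_l x := ((s.exists_density_bounds hd).choose_spec.choose_spec.2.2 x).2
  l_lt_one := (s.exists_density_bounds hd).choose_spec.choose_spec.2.1
  lipschitz x y := by
    have h1 := s.lipschitz.dist_le_mul (x + 1) (y + 1)
    have h2 := s.lipschitz.dist_le_mul x y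
    rw [Real.dist_eq, Real.dist_eq] at h1 h2
    rw [add_sub_add_right_eq_sub] at h1
    have e : s.density x - s.density y
        = (s.S (x + 1) - s.S (y + 1)) - (s.S x - s.S y) := by
      rw [density, density]; ring
    rw [e]
    linarith [abs_sub (s.S (x + 1) - s.S (y + 1)) (s.S x - s.S y)]
  map_zero := by simp
  sum_eq x := by
    have h : ∀ j : ℕ, (∫ y in 0..(x + j), s.density y) - (∫ y in 0..(j : ℝ), s.density y)
        = ∫ y in 0..x, s.density (y + j) := by
      intro j
      rw [intervalIntegral.integral_comp_add_right, zero_add]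
      exact intervalIntegral.integral_interval_sub_left (s.intervalIntegrable_density 0 _)
          (s.intervalIntegrable_density 0 _)
    simp only [h]
    have hi : ∀ j ∈ Finset.range d,
        IntervalIntegrable (fun y => s.density (y + (j : ℕ))) volume 0 x := fun j _ =>
      (s.continuous_density.comp (continuous_add_const _)).intervalIntegrable _ _
    rw [← intervalIntegral.integral_finsetSum hi]
    simp [s.sum_density]

end Staircase

/-- The steep staircase `⌊u⌋ + 1 - (1 - fract u) ^ k`. -/
def steep (k : ℕ) (u : ℝ) : ℝ := ⌊u⌋ + 1 - (1 - Int.fract u) ^ k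

/-! ### Monotonicity and Lipschitz bound of the steep staircase -/

theorem floor_le_steep (k : ℕ) (u : ℝ) : ⌊u⌋ ≤ steep k u := by
  have := pow_le_one₀ (n := k) (sub_nonneg.2 (Int.fract_lt_one u).le)
    (by linarith [Int.fract_nonneg u])
  rw [steep]
  linarith

theorem steep_lt (k : ℕ) (u : ℝ) : steep k u < ⌊u⌋ + 1 := by
  have := pow_pos (sub_pos.2 (Int.fract_lt_one u)) k
  rw [steep]
  linarith

theorem steep_add_one (k : ℕ) (u : ℝ) : steep k (u + 1) = steep k u + 1 := by
  rw [steep, steep, Int.floor_add_one, Int.fract_add_one]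
  push_cast
  ring

theorem strictMono_steep {k : ℕ} (hk : 0 < k) : StrictMono (steep k) := by
  intro u v h
  rcases (Int.floor_mono h.le).eq_or_lt with e | e
  · have hf : Int.fract u < Int.fract v := by
      rw [Int.fract, Int.fract, e]
      linarith
    have := pow_lt_pow_left₀ (show 1 - Int.fract v < 1 - Int.fract u by linarith)
      (by linarith [Int.fract_lt_one v]) hk.ne'
    rw [steep, steep, e]
    linarith
  · have : (⌊u⌋ : ℝ) + 1 ≤ ⌊v⌋ := by exact_mod_cast e
    exact (steep_lt k u).trans_le (this.trans (floor_le_steep k v))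

theorem pow_sub_pow_le_mul {a b : ℝ} (ha : 0 ≤ a) (hab : a ≤ b) (hb : b ≤ 1) (k : ℕ) :
    b ^ k - a ^ k ≤ k * (b - a) := by
  induction k with
  | zero => simp
  | succ k ih =>
    have h1 : a * (b ^ k - a ^ k) ≤ b ^ k - a ^ k :=
      mul_le_of_le_one_left (sub_nonneg.2 (pow_le_pow_left₀ ha hab k)) (hab.trans hb)
    have h2 : b ^ k * (b - a) ≤ b - a :=
      mul_le_of_le_one_left (by linarith) (pow_le_one₀ (ha.trans hab) hb)
    calc b ^ (k + 1) - a ^ (k + 1) = a * (b ^ k - a ^ k) + b ^ k * (b - a) := by ring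
      _ ≤ _ := by push_cast; linarith

theorem steep_sub_le {k : ℕ} (hk : 0 < k) {u v : ℝ} (h : u ≤ v) :
    steep k v - steep k u ≤ k * (v - u) := by
  have hu := Int.fract_nonneg u
  have hu' := Int.fract_lt_one u
  have hv := Int.fract_nonneg v
  have hv' := Int.fract_lt_one v
  have eu := Int.floor_add_fract u
  have ev := Int.floor_add_fract v
  rcases (Int.floor_mono h).eq_or_lt with e | e
  · rw [← e] at ev
    have := pow_sub_pow_le_mul (show 0 ≤ 1 - Int.fract v by linarith)
      (show 1 - Int.fract v ≤ 1 - Int.fract u by linarith) (by linarith) k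
    rw [steep, steep, ← e]
    have e2 : v - u = (1 - Int.fract u) - (1 - Int.fract v) := by linarith
    rw [e2]
    linarith
  -- Cut `[u, v]` at the integers `⌊u⌋ + 1` and `⌊v⌋`: the power estimate handles both ends, and in
  -- between the increment equals the length.
  · have h1 : (⌊u⌋ : ℝ) + 1 ≤ ⌊v⌋ := by exact_mod_cast e
    have h2 := pow_sub_pow_le_mul (show (0 : ℝ) ≤ 0 by rfl)
      (show 0 ≤ 1 - Int.fract u by linarith) (by linarith) k
    have h3 := pow_sub_pow_le_mul (show 0 ≤ 1 - Int.fract v by linarith)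
      (show 1 - Int.fract v ≤ 1 by linarith) le_rfl k
    rw [zero_pow hk.ne'] at h2
    rw [one_pow] at h3
    have hk1 : (1 : ℝ) ≤ k := by exact_mod_cast hk
    have h4 := mul_le_mul_of_nonneg_right hk1 (sub_nonneg.2 h1)
    have e2 : v - u = (⌊v⌋ - (⌊u⌋ + 1)) + (Int.fract v + (1 - Int.fract u)) := by linarith
    rw [e2, mul_add, mul_add, steep, steep]
    linarith

/-- The steep staircase of period `d`. -/
def steepStaircase (d k : ℕ) (hd : 2 ≤ d) (hk : 0 < k) : Staircase d where
  S y := steep k (y / d)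
  K := k
  strictMono := (strictMono_steep hk).comp fun x y h =>
    div_lt_div_of_pos_right h (by positivity)
  lipschitz := by
    have hd1 : (1 : ℝ) ≤ d := by exact_mod_cast (by omega : 1 ≤ d)
    refine LipschitzWith.of_le_add_mul _ fun x y => ?_
    rw [NNReal.coe_natCast]
    rcases le_total x y with h | h
    · have := (strictMono_steep hk).monotone (div_le_div_of_nonneg_right h (by positivity : 0 ≤ (d : ℝ)))
      have := mul_nonneg (Nat.cast_nonneg (α := ℝ) k) (dist_nonneg (x := x) (y := y))
      linarith
    · have h1 := steep_sub_le hk (div_le_div_of_nonneg_right h (by positivity : 0 ≤ (d : ℝ)))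
      have h2 : x / d - y / d ≤ x - y := by
        rw [← sub_div]
        exact div_le_self (by linarith) hd1
      have h3 := mul_le_mul_of_nonneg_left h2 (Nat.cast_nonneg (α := ℝ) k)
      rw [Real.dist_eq, abs_of_nonneg (by linarith)]
      linarith
  add_period y := by
    rw [add_div, div_self (by positivity), steep_add_one]

/-- There are Lebesgue-preserving examples with one very long Markov interval. -/
theorem exists_inverseLift_long (d : ℕ) (hd : 2 ≤ d) {δ : ℝ} (hδ : 0 < δ) :
    ∃ e : InverseLift d, 1 - δ ≤ e.E d - e.E (d - 1) := by
  -- The last interval misses at most the integral of `(1 - v / d) ^ k` over `[0, 1]`, which is at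
  -- most `d / (k + 1)`, hence below `δ` for this `k`.
  obtain ⟨k, hk⟩ := exists_nat_gt (d / δ)
  have hd0 : (0 : ℝ) < d := by positivity
  have hk0 : (0 : ℝ) < k := (by positivity : 0 < d / δ).trans hk
  let s := steepStaircase d k hd (by exact_mod_cast hk0)
  refine ⟨s.inverseLift hd, ?_⟩
  -- The window from `v + d - 1` to `v + d` contains the point `d`, just after which `S` rises by
  -- almost 1.
  have hS : ∀ v ∈ Icc (0 : ℝ) 1, 1 - (1 - v / d) ^ k ≤ s.density (v + (d - 1)) := by
    intro v hv
    have hd2 : (2 : ℝ) ≤ d := by exact_mod_cast hd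
    have hv1 : v / d < 1 := by
      rw [div_lt_one hd0]
      linarith [hv.2]
    have hv0 : 0 ≤ v / d := div_nonneg hv.1 hd0.le
    have e1 : s.S (v + (d - 1) + 1) = 2 - (1 - v / d) ^ k := by
      have : s.S v = 1 - (1 - v / d) ^ k := by
        change steep k (v / d) = _
        rw [steep, Int.floor_eq_zero_iff.2 ⟨hv0, hv1⟩, Int.fract_eq_self.2 ⟨hv0, hv1⟩]
        simp
      rw [show v + (d - 1) + 1 = v + d by ring, s.add_period, this]
      ring
    have e2 : s.S (v + (d - 1)) ≤ 1 := by
      have h1 : s.S d = 1 := by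
        have := s.add_period 0
        rw [zero_add] at this
        rw [this]
        change steep k (0 / d) + 1 = 1
        simp [steep]
      rw [← h1]
      exact s.strictMono.monotone (by linarith [hv.2])
    rw [Staircase.density, e1]
    linarith
  have hE : (s.inverseLift hd).E d - (s.inverseLift hd).E (d - 1)
      = ∫ v in (0 : ℝ)..1, s.density (v + (d - 1)) := by
    change (∫ y in 0..(d : ℝ), s.density y) - (∫ y in 0..((d : ℝ) - 1), s.density y) = _
    rw [intervalIntegral.integral_comp_add_right, zero_add, add_sub_cancel]
    exact intervalIntegral.integral_interval_sub_left (s.intervalIntegrable_density 0 _)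
          (s.intervalIntegrable_density 0 _)
  have hlow : ∫ v in (0 : ℝ)..1, (1 - (1 - v / d) ^ k)
      = 1 - d / (k + 1) * (1 - (1 - 1 / d) ^ (k + 1)) := by
    have hder : ∀ v ∈ uIcc (0 : ℝ) 1, HasDerivAt
        (fun v : ℝ => v + d / (k + 1) * (1 - v / d) ^ (k + 1)) (1 - (1 - v / d) ^ k) v := by
      intro v _
      have h1 : HasDerivAt (fun v : ℝ => 1 - v / d) (-(1 / d)) v :=
        ((hasDerivAt_id v).div_const _).const_sub 1
      have h2 := ((h1.pow (k + 1)).const_mul (d / (k + 1) : ℝ))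
      refine ((hasDerivAt_id v).add h2).congr_deriv ?_
      rw [Nat.add_sub_cancel]
      push_cast
      field_simp
      ring
    rw [intervalIntegral.integral_eq_sub_of_hasDerivAt hder
      (Continuous.intervalIntegrable (by fun_prop) _ _)]
    simp
    ring
  rw [hE]
  refine le_trans ?_ (intervalIntegral.integral_mono_on zero_le_one
    (Continuous.intervalIntegrable (by fun_prop) _ _)
    ((s.continuous_density.comp (continuous_add_const _)).intervalIntegrable _ _) hS)
  rw [hlow]
  have h1 : (d : ℝ) / (k + 1) ≤ δ := by
    rw [div_lt_iff₀ hδ] at hk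
    rw [div_le_iff₀ (by positivity)]
    nlinarith
  have h2 : (1 - (1 - 1 / (d : ℝ)) ^ (k + 1)) ≤ 1 := by
    have : (0 : ℝ) ≤ 1 - 1 / d := by
      rw [sub_nonneg, div_le_one hd0]
      exact_mod_cast (by omega : 1 ≤ d)
    linarith [pow_nonneg this (k + 1)]
  have h3 := mul_le_mul_of_nonneg_left h2 (show (0 : ℝ) ≤ d / (k + 1) by positivity)
  linarith

namespace InverseLift

variable {d : ℕ} (e : InverseLift d)

/-! ### The circle endomorphism of an inverse lift -/

theorem ρ_pos (x : ℝ) : 0 < e.ρ x := e.c_pos.trans_le (e.c_le x)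

theorem l_pos : 0 < e.l := (e.ρ_pos 0).trans_le (e.le_l 0)

theorem K_nonneg : 0 ≤ e.K := by
  have := e.lipschitz 1 0
  simpa using (abs_nonneg _).trans this

theorem continuous_E : Continuous e.E :=
  continuous_iff_continuousAt.2 fun x => (e.hasDerivAt x).continuousAt

theorem continuous_ρ : Continuous e.ρ := by
  refine (LipschitzWith.of_dist_le_mul (K := ⟨e.K, e.K_nonneg⟩) fun x y => ?_).continuous
  rw [Real.dist_eq, Real.dist_eq]
  exact e.lipschitz x y

theorem exists_slope {a b : ℝ} (h : a < b) : ∃ ξ ∈ Ioo a b, e.E b - e.E a = e.ρ ξ * (b - a) := by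
  obtain ⟨ξ, hξ, h2⟩ := exists_hasDerivAt_eq_slope e.E e.ρ h e.continuous_E.continuousOn
    fun x _ => e.hasDerivAt x
  exact ⟨ξ, hξ, by rw [h2, div_mul_cancel₀ _ (sub_pos.2 h).ne']⟩

theorem strictMono : StrictMono e.E := by
  intro a b h
  obtain ⟨ξ, -, h2⟩ := e.exists_slope h
  have := mul_pos (e.ρ_pos ξ) (sub_pos.2 h)
  linarith

theorem E_sub_le {a b : ℝ} (h : a ≤ b) : e.E b - e.E a ≤ e.l * (b - a) := by
  rcases h.eq_or_lt with rfl | h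
  · simp
  · obtain ⟨ξ, -, h2⟩ := e.exists_slope h
    rw [h2]
    exact mul_le_mul_of_nonneg_right (e.le_l ξ) (sub_pos.2 h).le

theorem le_E_sub {a b : ℝ} (h : a ≤ b) : e.c * (b - a) ≤ e.E b - e.E a := by
  rcases h.eq_or_lt with rfl | h
  · simp
  · obtain ⟨ξ, -, h2⟩ := e.exists_slope h
    rw [h2]
    exact mul_le_mul_of_nonneg_right (e.c_le ξ) (sub_pos.2 h).le

theorem surjective : Function.Surjective e.E := by
  refine e.continuous_E.surjective ?_ ?_
  · refine tendsto_atTop_mono' _ ?_ (tendsto_id.const_mul_atTop e.c_pos)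
    filter_upwards [eventually_ge_atTop 0] with x hx
    simpa [e.map_zero] using e.le_E_sub hx
  · refine tendsto_atBot_mono' _ ?_ (tendsto_id.const_mul_atBot e.c_pos)
    filter_upwards [eventually_le_atBot 0] with x hx
    simpa [e.map_zero] using e.le_E_sub hx

/-- The difference of `sum_eq` at `x + 1` and at `x` telescopes. -/
theorem E_add_period (x : ℝ) : e.E (x + d) = e.E x + 1 := by
  have h1 := e.sum_eq (x + 1)
  have h2 := e.sum_eq x
  have h3 := Finset.sum_range_sub (fun j : ℕ => e.E (x + j)) d
  rw [Finset.sum_sub_distrib] at h1 h2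
  rw [Finset.sum_sub_distrib] at h3
  simp only [Nat.cast_add, Nat.cast_one, Nat.cast_zero, add_zero] at h3
  have h4 : ∑ j ∈ Finset.range d, e.E (x + 1 + j) = ∑ j ∈ Finset.range d, e.E (x + (j + 1)) :=
    Finset.sum_congr rfl fun j _ => by rw [add_assoc, add_comm (1 : ℝ)]
  linarith

/-- The inverse lift as an order isomorphism. -/
def iso : ℝ ≃o ℝ := e.strictMono.orderIsoOfSurjective e.E e.surjective

theorem iso_apply (x : ℝ) : e.iso x = e.E x := rfl

/-- The circle endomorphism. -/
def endo : CircleEndo d where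
  lift := e.iso.symm
  map_add_one x := by
    rw [OrderIso.symm_apply_eq, iso_apply, e.E_add_period, ← iso_apply, OrderIso.apply_symm_apply]
  map_zero := by rw [OrderIso.symm_apply_eq, iso_apply, e.map_zero]

theorem endo_lift_symm : (e.endo.lift.symm : ℝ → ℝ) = e.E := rfl

theorem E_lift (x : ℝ) : e.E (e.endo.lift x) = x := e.iso.apply_symm_apply x

theorem hasDerivAt_lift (x : ℝ) :
    HasDerivAt e.endo.lift (e.ρ (e.endo.lift x))⁻¹ x :=
  (e.hasDerivAt _).of_local_left_inverse e.endo.lift.continuous.continuousAt (e.ρ_pos _).ne'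
    (Eventually.of_forall e.E_lift)

theorem deriv_lift : deriv e.endo.lift = fun x => (e.ρ (e.endo.lift x))⁻¹ :=
  funext fun x => (e.hasDerivAt_lift x).deriv

theorem contDiff_lift : ContDiff ℝ 1 e.endo.lift := by
  rw [contDiff_one_iff_deriv]
  refine ⟨fun x => (e.hasDerivAt_lift x).differentiableAt, ?_⟩
  rw [e.deriv_lift]
  exact (e.continuous_ρ.comp e.endo.lift.continuous).inv₀ fun x => (e.ρ_pos _).ne'

theorem isExpanding : e.endo.IsExpanding := by
  refine ⟨e.contDiff_lift, 1, one_pos, e.l⁻¹, one_lt_inv₀ e.l_pos |>.2 e.l_lt_one,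
    fun n _ x => ?_⟩
  have key : ∀ n : ℕ, ∀ x, ∃ D, e.l⁻¹ ^ n ≤ D ∧ HasDerivAt e.endo.lift^[n] D x := by
    intro n
    induction n with
    | zero => exact fun x => ⟨1, by simp, hasDerivAt_id x⟩
    | succ n ih =>
      intro x
      obtain ⟨D, hD, hx⟩ := ih (e.endo.lift x)
      refine ⟨_, ?_, hx.comp x (e.hasDerivAt_lift x)⟩
      rw [pow_succ]
      exact mul_le_mul hD (inv_anti₀ (e.ρ_pos _) (e.le_l _)) (inv_nonneg.2 e.l_pos.le)
        ((pow_nonneg (inv_nonneg.2 e.l_pos.le) n).trans hD)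
  obtain ⟨D, hD, hx⟩ := key n x
  rw [hx.deriv, one_mul]
  exact hD

theorem abs_lift_sub_le (x y : ℝ) :
    |e.endo.lift x - e.endo.lift y| ≤ e.c⁻¹ * |x - y| := by
  wlog h : y ≤ x generalizing x y
  · rw [abs_sub_comm, abs_sub_comm x]
    exact this y x (le_of_not_ge h)
  have h2 := e.endo.lift.monotone h
  have h3 := e.le_E_sub h2
  rw [e.E_lift, e.E_lift] at h3
  rw [abs_of_nonneg (sub_nonneg.2 h), abs_of_nonneg (sub_nonneg.2 h2),
    inv_mul_eq_div, le_div_iff₀ e.c_pos]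
  linarith

theorem abs_deriv_sub_le (x y : ℝ) :
    |deriv e.endo.lift x - deriv e.endo.lift y| ≤ e.K / e.c ^ 3 * |x - y| := by
  simp only [e.deriv_lift]
  set a := e.endo.lift x
  set b := e.endo.lift y
  have h1 := e.lipschitz b a
  have h2 := e.abs_lift_sub_le x y
  rw [inv_sub_inv (e.ρ_pos _).ne' (e.ρ_pos _).ne', abs_div,
    abs_of_pos (mul_pos (e.ρ_pos a) (e.ρ_pos b)),
    div_le_iff₀ (mul_pos (e.ρ_pos a) (e.ρ_pos b))]
  have h3 : e.c * e.c ≤ e.ρ a * e.ρ b :=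
    mul_le_mul (e.c_le a) (e.c_le b) e.c_pos.le (e.ρ_pos a).le
  have hK := e.K_nonneg
  have hc := e.c_pos
  calc |e.ρ b - e.ρ a| ≤ e.K * |b - a| := h1
    _ ≤ e.K * (e.c⁻¹ * |x - y|) := by
      rw [abs_sub_comm]
      exact mul_le_mul_of_nonneg_left h2 hK
    _ = e.K / e.c ^ 3 * |x - y| * (e.c * e.c) := by field_simp
    _ ≤ _ := mul_le_mul_of_nonneg_left h3 (by positivity)

/-- A Lipschitz derivative is Hölder at distances at most 1; at larger distances its bound `c⁻¹`
suffices. -/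
theorem isC1Holder {α : ℝ≥0} (h1 : α ≤ 1) : e.endo.IsC1Holder α := by
  have hK := e.K_nonneg
  have hc := e.c_pos
  refine ⟨e.contDiff_lift, (e.K / e.c ^ 3 + e.c⁻¹).toNNReal, fun x y => ?_⟩
  have hb : ∀ x, 0 ≤ deriv e.endo.lift x ∧ deriv e.endo.lift x ≤ e.c⁻¹ := fun x => by
    rw [e.deriv_lift]
    exact ⟨inv_nonneg.2 (e.ρ_pos _).le, inv_anti₀ e.c_pos (e.c_le _)⟩
  have key : dist (deriv e.endo.lift x) (deriv e.endo.lift y)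
      ≤ (e.K / e.c ^ 3 + e.c⁻¹) * dist x y ^ (α : ℝ) := by
    rw [Real.dist_eq, Real.dist_eq]
    have hr := Real.rpow_nonneg (abs_nonneg (x - y)) (α : ℝ)
    rw [add_mul]
    rcases le_total |x - y| 1 with h | h
    · have h2 : |x - y| ≤ |x - y| ^ (α : ℝ) := by
        rcases (abs_nonneg (x - y)).eq_or_lt with h' | h'
        · rw [← h']
          positivity
        · simpa using Real.rpow_le_rpow_of_exponent_ge h' h (show (α : ℝ) ≤ 1 by exact_mod_cast h1)
      have h3 := mul_le_mul_of_nonneg_left h2 (show 0 ≤ e.K / e.c ^ 3 by positivity)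
      have h4 : 0 ≤ e.c⁻¹ * |x - y| ^ (α : ℝ) := by positivity
      linarith [e.abs_deriv_sub_le x y]
    · have h2 : 1 ≤ |x - y| ^ (α : ℝ) := Real.one_le_rpow h α.2
      have h3 := mul_le_mul_of_nonneg_left h2 (show 0 ≤ e.c⁻¹ by positivity)
      have h4 : 0 ≤ e.K / e.c ^ 3 * |x - y| ^ (α : ℝ) := by positivity
      have h5 : |deriv e.endo.lift x - deriv e.endo.lift y| ≤ e.c⁻¹ := by
        rw [abs_le]
        constructor <;> linarith [hb x, hb y]
      linarith
  rw [edist_dist, edist_dist, ENNReal.ofReal_rpow_of_nonneg dist_nonneg α.coe_nonneg, ← ENNReal.ofReal,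
    ← ENNReal.ofReal_mul (by positivity)]
  exact ENNReal.ofReal_le_ofReal key

/-! ### Bounded distortion -/

theorem iterate_sub_le (n : ℕ) {a b : ℝ} (h : a ≤ b) :
    e.E^[n] b - e.E^[n] a ≤ e.l ^ n * (b - a) := by
  induction n with
  | zero => simp
  | succ n ih =>
    rw [Function.iterate_succ_apply', Function.iterate_succ_apply', pow_succ', mul_assoc]
    exact (e.E_sub_le ((e.strictMono.iterate n).monotone h)).trans
      (mul_le_mul_of_nonneg_left ih e.l_pos.le)

theorem abs_log_ρ_sub_le (x y : ℝ) :
    |Real.log (e.ρ x) - Real.log (e.ρ y)| ≤ e.K / e.c * |x - y| := by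
  have key : ∀ x y, Real.log (e.ρ x) - Real.log (e.ρ y) ≤ e.K / e.c * |x - y| := by
    intro x y
    rw [← Real.log_div (e.ρ_pos x).ne' (e.ρ_pos y).ne']
    refine (Real.log_le_sub_one_of_pos (div_pos (e.ρ_pos x) (e.ρ_pos y))).trans ?_
    rw [div_sub_one (e.ρ_pos y).ne', div_le_iff₀ (e.ρ_pos y)]
    have h1 := (le_abs_self _).trans (e.lipschitz x y)
    have hK := e.K_nonneg
    have hc := e.c_pos
    have h2 := mul_le_mul_of_nonneg_left (e.c_le y)
      (show 0 ≤ e.K / e.c * |x - y| by positivity)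
    have h3 : e.K / e.c * |x - y| * e.c = e.K * |x - y| := by field_simp
    linarith
  refine abs_sub_le_iff.2 ⟨key x y, ?_⟩
  rw [abs_sub_comm]
  exact key y x

/-- The distortion constant. -/
def M : ℝ := e.K / e.c / (1 - e.l)

theorem M_nonneg : 0 ≤ e.M :=
  div_nonneg (div_nonneg e.K_nonneg e.c_pos.le) (sub_pos.2 e.l_lt_one).le

/-- Lengths of subintervals of an interval of length `R` are distorted by at most `exp (M R)`. -/
theorem distortion (n : ℕ) {R x₀ a b a' b' : ℝ} (hab : a < b) (hab' : a' < b')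
    (ha : x₀ ≤ a) (hb : b ≤ x₀ + R) (ha' : x₀ ≤ a') (hb' : b' ≤ x₀ + R) :
    (e.E^[n] b - e.E^[n] a) * (b' - a') ≤
      Real.exp (e.M * R) * ((e.E^[n] b' - e.E^[n] a') * (b - a)) := by
  have hR : 0 ≤ R := by linarith
  -- The induction carries the partial geometric sum in the exponent; the full series is bounded by
  -- `M R` only at the end.
  have key : (e.E^[n] b - e.E^[n] a) * (b' - a') ≤
      Real.exp (∑ i ∈ Finset.range n, e.K / e.c * (e.l ^ i * R)) *
        ((e.E^[n] b' - e.E^[n] a') * (b - a)) := by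
    induction n with
    | zero => simp [mul_comm]
    | succ n ih =>
      have hm := e.strictMono.iterate n
      obtain ⟨ξ, hξ, h1⟩ := e.exists_slope (hm hab)
      obtain ⟨η, hη, h2⟩ := e.exists_slope (hm hab')
      simp only [Function.iterate_succ_apply', h1, h2]
      -- Both mean-value points lie in the `n`-th image of `[x₀, x₀ + R]`, so one more iterate costs
      -- only `exp (K / c * l ^ n * R)`.
      have hdist : |ξ - η| ≤ e.l ^ n * R := by
        have h3 := e.iterate_sub_le n (show x₀ ≤ x₀ + R by linarith)
        rw [add_sub_cancel_left] at h3
        have h4 := hm.monotone ha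
        have h5 := hm.monotone hb
        have h6 := hm.monotone ha'
        have h7 := hm.monotone hb'
        rw [abs_le]
        constructor <;> linarith [hξ.1, hξ.2, hη.1, hη.2]
      have hρ : e.ρ ξ ≤ Real.exp (e.K / e.c * (e.l ^ n * R)) * e.ρ η := by
        have h3 := (le_abs_self _).trans (e.abs_log_ρ_sub_le ξ η)
        have h4 := mul_le_mul_of_nonneg_left hdist
          (show 0 ≤ e.K / e.c from div_nonneg e.K_nonneg e.c_pos.le)
        calc e.ρ ξ = Real.exp (Real.log (e.ρ ξ)) := (Real.exp_log (e.ρ_pos ξ)).symm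
          _ ≤ Real.exp (e.K / e.c * (e.l ^ n * R) + Real.log (e.ρ η)) :=
            Real.exp_le_exp.2 (by linarith)
          _ = _ := by rw [Real.exp_add, Real.exp_log (e.ρ_pos η)]
      rw [Finset.sum_range_succ, Real.exp_add]
      have hpos : 0 ≤ (e.E^[n] b - e.E^[n] a) * (b' - a') :=
        mul_nonneg (sub_pos.2 (hm hab)).le (sub_pos.2 hab').le
      have := mul_le_mul hρ ih hpos (mul_nonneg (Real.exp_nonneg _) (e.ρ_pos η).le)
      calc e.ρ ξ * (e.E^[n] b - e.E^[n] a) * (b' - a')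
          = e.ρ ξ * ((e.E^[n] b - e.E^[n] a) * (b' - a')) := by ring
        _ ≤ _ := this
        _ = _ := by ring
  refine key.trans (mul_le_mul_of_nonneg_right (Real.exp_le_exp.2 ?_) ?_)
  · rw [← Finset.mul_sum, ← Finset.sum_mul, M, div_eq_mul_inv (e.K / e.c), mul_assoc]
    refine mul_le_mul_of_nonneg_left ?_ (div_nonneg e.K_nonneg e.c_pos.le)
    refine mul_le_mul_of_nonneg_right ?_ hR
    rw [← tsum_geometric_of_lt_one e.l_pos.le e.l_lt_one]
    exact (summable_geometric_of_lt_one e.l_pos.le e.l_lt_one).sum_le_tsum _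
      fun i _ => pow_nonneg e.l_pos.le i
  · exact mul_nonneg (sub_pos.2 (e.strictMono.iterate n hab')).le (sub_pos.2 hab).le

/-! ### Uniform symmetry of the inverse iterates -/

theorem iterate_add_nat (n : ℕ) (x : ℝ) (m : ℕ) :
    e.E^[n] (x + m * d ^ n) = e.E^[n] x + m := by
  have h1 : ∀ x (m : ℕ), e.E (x + m * d) = e.E x + m := by
    intro x m
    induction m with
    | zero => simp
    | succ m ih =>
      push_cast
      rw [add_mul, one_mul, ← add_assoc, e.E_add_period, ih, add_assoc]
  induction n generalizing x with
  | zero => simp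
  | succ n ih =>
    rw [Function.iterate_succ_apply, Function.iterate_succ_apply, ← ih]
    congr 1
    have := h1 x (m * d ^ n)
    push_cast at this
    rw [← this]
    congr 1
    ring

/-- Two adjacent intervals of length `t` fill an interval of length `R = 2 t`, so distortion gives a
constant, independent of `n`, that tends to 1 with `t`. -/
theorem iterate_sub_le_exp_mul (n : ℕ) {t : ℝ} (ht : 0 < t) {x y : ℝ} (hxy : y = x + t ∨ x = y + t) :
    e.E^[n] (x + t) - e.E^[n] x ≤
      Real.exp (2 * e.M * t) * (e.E^[n] (y + t) - e.E^[n] y) := by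
  have hM : e.M * (2 * t) = 2 * e.M * t := by ring
  rcases hxy with rfl | rfl
  · have := e.distortion n (R := 2 * t) (x₀ := x) (show x < x + t by linarith)
      (show x + t < x + t + t by linarith) le_rfl (by linarith) (by linarith) (by linarith)
    rw [hM, add_sub_cancel_left, add_sub_cancel_left, ← mul_assoc] at this
    exact le_of_mul_le_mul_right this ht
  · have := e.distortion n (R := 2 * t) (x₀ := y) (show y + t < y + t + t by linarith)
      (show y < y + t by linarith) (by linarith) (by linarith) (by linarith) (by linarith)
    rw [hM, add_sub_cancel_left, add_sub_cancel_left, ← mul_assoc] at this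
    exact le_of_mul_le_mul_right this ht

theorem le_iterate_sub (n m : ℕ) {x t : ℝ} (h : m * (d : ℝ) ^ n ≤ t) :
    (m : ℝ) ≤ e.E^[n] (x + t) - e.E^[n] x := by
  have := (e.strictMono.iterate n).monotone (show x + m * (d : ℝ) ^ n ≤ x + t by linarith)
  rw [e.iterate_add_nat] at this
  linarith

theorem iterate_sub_le_nat (n m : ℕ) {x t : ℝ} (h : t ≤ m * (d : ℝ) ^ n) :
    e.E^[n] (x + t) - e.E^[n] x ≤ m := by
  have := (e.strictMono.iterate n).monotone (show x + t ≤ x + m * (d : ℝ) ^ n by linarith)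
  rw [e.iterate_add_nat] at this
  linarith

/-- For large `t` distortion at scale `t` gives no uniform bound. Take `d ^ r ≤ t < d ^ (r + 1)`. If
`n ≤ r`, periodicity puts both increments between `q` and `q + 1` with `q = ⌊t / d ^ n⌋ ≥ 1`. If `n
> r`, the iterate `E^[r]` brings the lengths into `[1, d]`, and distortion with `R = 2 d` controls
the remaining iterates. -/
theorem iterate_sub_le_of_one_le (hd : 2 ≤ d) (n : ℕ) {t : ℝ} (ht : 1 ≤ t) {x y : ℝ}
    (hxy : y = x + t ∨ x = y + t) :
    e.E^[n] (x + t) - e.E^[n] x ≤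
      d * Real.exp (2 * d * e.M) * (e.E^[n] (y + t) - e.E^[n] y) := by
  have hd2 : (2 : ℝ) ≤ d := by exact_mod_cast hd
  have hM := e.M_nonneg
  have hexp : 1 ≤ Real.exp (2 * d * e.M) := Real.one_le_exp (by positivity)
  obtain ⟨r, hr1, hr2⟩ := exists_nat_pow_near ht (show (1 : ℝ) < d by linarith)
  rcases le_or_gt n r with h | h
  · have ht' : (d : ℝ) ^ n ≤ t := (pow_le_pow_right₀ (by linarith) h).trans hr1
    have hpos : (0 : ℝ) < d ^ n := by positivity
    have hq : 1 ≤ ⌊t / d ^ n⌋₊ := (Nat.one_le_floor_iff _).2 ((one_le_div hpos).2 ht')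
    have hq' : (1 : ℝ) ≤ ⌊t / d ^ n⌋₊ := by exact_mod_cast hq
    have h1 := e.le_iterate_sub n ⌊t / d ^ n⌋₊ (x := y) (t := t)
      ((le_div_iff₀ hpos).1 (Nat.floor_le (by positivity)))
    have h2 := e.iterate_sub_le_nat n (⌊t / d ^ n⌋₊ + 1) (x := x) (t := t)
      ((div_le_iff₀ hpos).1 (by push_cast; exact (Nat.lt_floor_add_one _).le))
    push_cast at h2
    have h3 : (2 : ℝ) ≤ d * Real.exp (2 * d * e.M) := by nlinarith
    nlinarith
  · obtain ⟨m, rfl⟩ := Nat.exists_eq_add_of_lt h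
    have hm := e.strictMono.iterate r
    have hlow : ∀ z, (1 : ℝ) ≤ e.E^[r] (z + t) - e.E^[r] z := fun z => by
      simpa using e.le_iterate_sub r 1 (x := z) (t := t) (by simpa using hr1)
    have hup : ∀ z, e.E^[r] (z + t) - e.E^[r] z ≤ d := fun z =>
      e.iterate_sub_le_nat r d (by rw [← pow_succ']; exact hr2.le)
    have hx := hlow x
    have hy := hlow y
    have hx' := hup x
    have hy' := hup y
    have hS : ∀ z, e.E^[r + m + 1] z = e.E^[m + 1] (e.E^[r] z) := fun z => by
      rw [← Function.iterate_add_apply, add_comm (m + 1), add_assoc]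
    have key : (e.E^[m + 1] (e.E^[r] (x + t)) - e.E^[m + 1] (e.E^[r] x)) *
        (e.E^[r] (y + t) - e.E^[r] y) ≤ Real.exp (e.M * (2 * d)) *
        ((e.E^[m + 1] (e.E^[r] (y + t)) - e.E^[m + 1] (e.E^[r] y)) *
          (e.E^[r] (x + t) - e.E^[r] x)) := by
      rcases hxy with rfl | rfl
      · exact e.distortion (m + 1) (x₀ := e.E^[r] x) (by linarith) (by linarith) le_rfl
          (by linarith) (by linarith) (by linarith)
      · exact e.distortion (m + 1) (x₀ := e.E^[r] y) (by linarith) (by linarith) (by linarith)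
          (by linarith) le_rfl (by linarith)
    simp only [hS]
    have hmono := e.strictMono.iterate (m + 1)
    have hU := sub_pos.2 (hmono (show e.E^[r] x < e.E^[r] (x + t) by linarith))
    have hV := sub_pos.2 (hmono (show e.E^[r] y < e.E^[r] (y + t) by linarith))
    calc _ ≤ (e.E^[m + 1] (e.E^[r] (x + t)) - e.E^[m + 1] (e.E^[r] x)) *
        (e.E^[r] (y + t) - e.E^[r] y) := le_mul_of_one_le_right hU.le hy
      _ ≤ _ := key
      _ ≤ Real.exp (e.M * (2 * d)) *
        ((e.E^[m + 1] (e.E^[r] (y + t)) - e.E^[m + 1] (e.E^[r] y)) * d) :=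
          mul_le_mul_of_nonneg_left (mul_le_mul_of_nonneg_left hx' hV.le) (Real.exp_nonneg _)
      _ = _ := by rw [mul_comm e.M]; ring

/-- The modulus of uniform symmetry. -/
def modulus (t : ℝ) : ℝ :=
  -- The summand `t` keeps the modulus positive when `M = 0`, as for the linear map.
  if t < 1 then Real.exp (2 * e.M * t) - 1 + t else d * Real.exp (2 * d * e.M)

theorem isModulus (hd : 2 ≤ d) : IsModulus e.modulus := by
  have hM := e.M_nonneg
  have hd0 : (0 : ℝ) < d := by positivity
  refine ⟨fun t ht => ?_, ⟨max (Real.exp (2 * e.M)) (d * Real.exp (2 * d * e.M)), fun t ht => ?_⟩,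
    ?_⟩
  · rw [modulus]
    split_ifs
    · have : 1 ≤ Real.exp (2 * e.M * t) := Real.one_le_exp (by positivity)
      linarith
    · positivity
  · rw [modulus]
    split_ifs with h
    · refine le_max_of_le_left ?_
      have : Real.exp (2 * e.M * t) ≤ Real.exp (2 * e.M) :=
        Real.exp_le_exp.2 (mul_le_of_le_one_right (by positivity) h.le)
      linarith
    · exact le_max_right _ _
  · have hc : Continuous fun t : ℝ => Real.exp (2 * e.M * t) - 1 + t := by fun_prop
    have h0 := (hc.tendsto 0).mono_left (nhdsWithin_le_nhds (s := Ioi 0))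
    simp only [mul_zero, Real.exp_zero, sub_self, add_zero] at h0
    refine h0.congr' ?_
    filter_upwards [nhdsWithin_le_nhds (Iio_mem_nhds one_pos)] with t ht
    exact (if_pos (mem_Iio.1 ht)).symm

theorem isUniformlySymmetric (hd : 2 ≤ d) : e.endo.IsUniformlySymmetric := by
  refine ⟨e.modulus, e.isModulus hd, fun n _ x t ht => ?_⟩
  rw [endo_lift_symm]
  have hm := e.strictMono.iterate n
  have key : ∀ x y, (y = x + t ∨ x = y + t) → e.E^[n] (x + t) - e.E^[n] x ≤
      (1 + e.modulus t) * (e.E^[n] (y + t) - e.E^[n] y) := by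
    intro x y hxy
    have hV := sub_pos.2 (hm (show y < y + t by linarith))
    rw [modulus]
    split_ifs with h
    · refine (e.iterate_sub_le_exp_mul n ht hxy).trans (mul_le_mul_of_nonneg_right ?_ hV.le)
      linarith
    · refine (e.iterate_sub_le_of_one_le hd n (not_lt.1 h) hxy).trans
        (mul_le_mul_of_nonneg_right ?_ hV.le)
      linarith
  -- The two symmetry bounds are one inequality with the adjacent intervals exchanged.
  have h1 := key x (x - t) (Or.inr (by ring))
  have h2 := key (x - t) x (Or.inl (by ring))
  rw [sub_add_cancel] at h1 h2
  have hU := sub_pos.2 (hm (show x < x + t by linarith))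
  have hV := sub_pos.2 (hm (show x - t < x by linarith))
  have hε := (e.isModulus hd).1 t ht
  rw [abs_of_pos hU, abs_of_pos hV]
  refine ⟨?_, (div_le_iff₀ hV).2 h1⟩
  rw [div_le_div_iff₀ (by linarith) hV]
  linarith

end InverseLift

/-! ### Maps of the circle and reflexivity of the equivalence -/

theorem CircleEndo.toMap_coe {d : ℕ} (f : CircleEndo d) (x : ℝ) :
    f.toMap (x : UnitAddCircle) = (f.lift x : UnitAddCircle) := rfl

theorem CircleHomeo.toMap_coe (h : CircleHomeo) (x : ℝ) :
    h.toMap (x : UnitAddCircle) = (h.lift x : UnitAddCircle) := rfl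

theorem CircleEndo.continuous_toMap {d : ℕ} (f : CircleEndo d) : Continuous f.toMap :=
  continuous_coinduced_dom.2 ((AddCircle.continuous_mk' 1).comp f.lift.continuous)

theorem isSymmetric_id : IsSymmetric (fun x => x) := by
  refine ⟨fun t => min t 1, ⟨fun t ht => lt_min ht one_pos, ⟨1, fun t _ => min_le_right _ _⟩, ?_⟩,
    fun x t ht => ?_⟩
  · have : Continuous fun t : ℝ => min t 1 := by fun_prop
    simpa using (this.tendsto 0).mono_left (nhdsWithin_le_nhds (s := Ioi 0))
  · have h : 0 < min t 1 := lt_min ht one_pos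
    simp only [add_sub_cancel_left, sub_sub_cancel, abs_of_pos ht, div_self ht.ne']
    exact ⟨(div_le_one (by linarith)).2 (by linarith), by linarith⟩

theorem MarkedEndo.equivalent_refl {d : ℕ} (p : MarkedEndo d) : p.Equivalent p := by
  unfold MarkedEndo.Equivalent
  simpa using isSymmetric_id

namespace InverseLift

variable {d : ℕ} (e : InverseLift d)

/-! ### The conjugacy with multiplication by `d` -/

theorem exists_displacement_bound :
    ∃ C, ∀ x, |e.endo.lift x - d * x| ≤ C := by
  have hp : Function.Periodic (fun x => |e.endo.lift x - d * x|) 1 := by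
    intro x
    simp only [e.endo.map_add_one]
    congr 1
    ring
  have hc : Continuous fun x => |e.endo.lift x - d * x| :=
    (e.endo.lift.continuous.sub (continuous_const.mul continuous_id)).abs
  obtain ⟨b, -, hb⟩ := isCompact_Icc.exists_isMaxOn (⟨0, by simp⟩ : (Icc (0 : ℝ) 1).Nonempty)
    hc.continuousOn
  refine ⟨|e.endo.lift b - d * b|, fun x => ?_⟩
  obtain ⟨z, hz, hxz⟩ := hp.exists_mem_Ico₀ one_pos x
  exact hxz.le.trans (hb (Ico_subset_Icc_self hz))

/-- The conjugacy from the endomorphism to multiplication by `d`. -/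
def conjugacy (x : ℝ) : ℝ :=
  x + ∑' n : ℕ, (e.endo.lift (e.endo.lift^[n] x) - d * e.endo.lift^[n] x) / d ^ (n + 1)

theorem exists_summable_bound (hd : 2 ≤ d) :
    ∃ u : ℕ → ℝ, Summable u ∧ ∀ n x,
      ‖(e.endo.lift (e.endo.lift^[n] x) - d * e.endo.lift^[n] x) / d ^ (n + 1)‖ ≤ u n := by
  obtain ⟨C, hC⟩ := e.exists_displacement_bound
  have hd2 : (2 : ℝ) ≤ d := by exact_mod_cast hd
  refine ⟨fun n => C / d * (1 / d) ^ n, (summable_geometric_of_lt_one (by positivity)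
    ((div_lt_one (by linarith)).2 (by linarith))).mul_left _, fun n x => ?_⟩
  rw [norm_div, Real.norm_eq_abs, Real.norm_of_nonneg (by positivity)]
  calc _ ≤ C / d ^ (n + 1) := div_le_div_of_nonneg_right (hC _) (by positivity)
    _ = C / d * (1 / (d : ℝ)) ^ n := by rw [one_div_pow, pow_succ]; field_simp

theorem continuous_conjugacy (hd : 2 ≤ d) : Continuous e.conjugacy := by
  obtain ⟨u, hu, hb⟩ := e.exists_summable_bound hd
  have hF : Continuous e.endo.lift := e.endo.lift.continuous
  refine continuous_id.add (continuous_tsum (fun n => ?_) hu hb)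
  exact (((hF.comp (hF.iterate n)).sub (continuous_const.mul (hF.iterate n))).div_const _)

/-- The series telescopes to `F^n x / d ^ n`. Monotonicity, equivariance and the conjugacy equation
are read off from this limit, continuity from the uniformly convergent series. -/
theorem tendsto_conjugacy (hd : 2 ≤ d) (x : ℝ) :
    Tendsto (fun n : ℕ => e.endo.lift^[n] x / d ^ n) atTop (𝓝 (e.conjugacy x)) := by
  obtain ⟨u, hu, hb⟩ := e.exists_summable_bound hd
  have hd0 : (d : ℝ) ≠ 0 := by positivity
  have h := ((Summable.of_norm_bounded hu fun n => hb n x).hasSum.tendsto_sum_nat).const_add x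
  refine h.congr fun n => ?_
  induction n with
  | zero => simp
  | succ n ih =>
    rw [Finset.sum_range_succ, ← add_assoc, ih, Function.iterate_succ_apply']
    field_simp
    ring

theorem iterate_lift_add_one (n : ℕ) (x : ℝ) :
    e.endo.lift^[n] (x + 1) = e.endo.lift^[n] x + d ^ n := by
  have h1 : ∀ (x : ℝ) (m : ℕ), e.endo.lift (x + m) = e.endo.lift x + m * d := by
    intro x m
    induction m with
    | zero => simp
    | succ m ih =>
      push_cast
      rw [← add_assoc, e.endo.map_add_one, ih]
      ring
  induction n with
  | zero => simp
  | succ n ih =>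
    rw [Function.iterate_succ_apply', Function.iterate_succ_apply', ih, ← Nat.cast_pow, h1]
    push_cast
    ring

theorem monotone_conjugacy (hd : 2 ≤ d) : Monotone e.conjugacy := fun x y h =>
  le_of_tendsto_of_tendsto' (e.tendsto_conjugacy hd x) (e.tendsto_conjugacy hd y) fun n =>
    div_le_div_of_nonneg_right (e.endo.lift.monotone.iterate n h) (by positivity)

theorem conjugacy_add_one (hd : 2 ≤ d) (x : ℝ) : e.conjugacy (x + 1) = e.conjugacy x + 1 := by
  have hd0 : (d : ℝ) ≠ 0 := by positivity
  refine tendsto_nhds_unique (e.tendsto_conjugacy hd (x + 1))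
    (((e.tendsto_conjugacy hd x).add_const 1).congr fun n => ?_)
  rw [e.iterate_lift_add_one, add_div, div_self (pow_ne_zero n hd0)]

theorem conjugacy_iterate (hd : 2 ≤ d) (n : ℕ) (x : ℝ) :
    e.conjugacy (e.endo.lift^[n] x) = d ^ n * e.conjugacy x := by
  have hd0 : (d : ℝ) ≠ 0 := by positivity
  have h := ((e.tendsto_conjugacy hd x).comp (tendsto_add_atTop_nat n)).const_mul ((d : ℝ) ^ n)
  refine tendsto_nhds_unique (e.tendsto_conjugacy hd _) (h.congr fun m => ?_)
  simp only [Function.comp]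
  rw [Function.iterate_add_apply, pow_add]
  field_simp

theorem conjugacy_zero : e.conjugacy 0 = 0 := by
  have h : ∀ n, e.endo.lift^[n] 0 = 0 := fun n => by
    induction n with
    | zero => rfl
    | succ n ih => rw [Function.iterate_succ_apply, e.endo.map_zero, ih]
  simp [conjugacy, h, e.endo.map_zero]

theorem iterate_E_iterate_lift (n : ℕ) (x : ℝ) : e.E^[n] (e.endo.lift^[n] x) = x :=
  (Function.LeftInverse.iterate (f := e.endo.lift) (g := e.E) e.E_lift n) x

/-- By expansion some iterate moves `x < y` at least 1 apart, where the monotone conjugacy gains at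
least 1; the conjugacy equation carries the strict inequality back. -/
theorem strictMono_conjugacy (hd : 2 ≤ d) : StrictMono e.conjugacy := by
  intro x y h
  obtain ⟨n, hn⟩ := exists_pow_lt_of_lt_one (sub_pos.2 h) e.l_lt_one
  have hm : e.endo.lift^[n] x ≤ e.endo.lift^[n] y := e.endo.lift.monotone.iterate n h.le
  have h1 := e.iterate_sub_le n hm
  rw [e.iterate_E_iterate_lift, e.iterate_E_iterate_lift] at h1
  have h2 : e.endo.lift^[n] x + 1 ≤ e.endo.lift^[n] y := by
    have hl := pow_pos e.l_pos n
    by_contra hcon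
    have := mul_le_mul_of_nonneg_left
      (show e.endo.lift^[n] y - e.endo.lift^[n] x ≤ 1 by linarith) hl.le
    linarith
  have h3 := e.monotone_conjugacy hd h2
  rw [e.conjugacy_add_one hd, e.conjugacy_iterate hd, e.conjugacy_iterate hd] at h3
  by_contra hcon
  have := mul_le_mul_of_nonneg_left (not_lt.1 hcon) (show (0 : ℝ) ≤ d ^ n by positivity)
  linarith

theorem surjective_conjugacy (hd : 2 ≤ d) : Function.Surjective e.conjugacy := by
  obtain ⟨u, hu, hb⟩ := e.exists_summable_bound hd
  have hbd : ∀ x, |e.conjugacy x - x| ≤ ∑' n, u n := fun x => by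
    rw [conjugacy, add_sub_cancel_left]
    exact tsum_of_norm_bounded hu.hasSum fun n => hb n x
  refine (e.continuous_conjugacy hd).surjective ?_ ?_
  · refine tendsto_atTop_mono (fun x => ?_) (tendsto_atTop_add_const_right _ (-∑' n, u n) tendsto_id)
    have := (abs_le.1 (hbd x)).1
    simp only [id]
    linarith
  · refine tendsto_atBot_mono (fun x => ?_) (tendsto_atBot_add_const_right _ (∑' n, u n) tendsto_id)
    have := (abs_le.1 (hbd x)).2
    simp only [id]
    linarith

/-- The conjugacy as an order isomorphism. -/
def conjIso (hd : 2 ≤ d) : ℝ ≃o ℝ :=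
  (e.strictMono_conjugacy hd).orderIsoOfSurjective e.conjugacy (e.surjective_conjugacy hd)

theorem conjIso_apply (hd : 2 ≤ d) (x : ℝ) : e.conjIso hd x = e.conjugacy x := rfl

theorem conjIso_symm_zero (hd : 2 ≤ d) : (e.conjIso hd).symm 0 = 0 := by
  rw [OrderIso.symm_apply_eq, conjIso_apply, conjugacy_zero]

/-- The endomorphism with its marking. -/
def marked (hd : 2 ≤ d) : MarkedEndo d where
  f := e.endo
  uniformlySymmetric := e.isUniformlySymmetric hd
  -- The marking goes from multiplication by `d` to the map, so it is the inverse of the conjugacy.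
  h :=
    { lift := (e.conjIso hd).symm
      map_add_one := fun x => by
        rw [OrderIso.symm_apply_eq, conjIso_apply, e.conjugacy_add_one hd, ← e.conjIso_apply hd,
          OrderIso.apply_symm_apply]
      map_zero_mem := by
        rw [e.conjIso_symm_zero hd]
        simp }
  h_zero := e.conjIso_symm_zero hd
  conj z := by
    induction z using QuotientAddGroup.induction_on with
    | H x =>
      have hdx : d • ((x : ℝ) : UnitAddCircle) = ((d * x : ℝ) : UnitAddCircle) := by
        rw [← nsmul_eq_mul]
        rfl
      rw [hdx, CircleHomeo.toMap_coe, CircleHomeo.toMap_coe, CircleEndo.toMap_coe]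
      congr 1
      rw [OrderIso.eq_symm_apply, conjIso_apply]
      have := e.conjugacy_iterate hd 1 ((e.conjIso hd).symm x)
      rw [Function.iterate_one, pow_one] at this
      rw [this, ← e.conjIso_apply hd, OrderIso.apply_symm_apply]

theorem mem_class (hd : 2 ≤ d) : e.marked hd ∈ {p : MarkedEndo d | p.Equivalent (e.marked hd)} :=
  MarkedEndo.equivalent_refl _

/-! ### Invariance of the Lebesgue measure -/

theorem volume_map_lift_sub (j : ℕ) (a b : ℝ) :
    volume.map (fun x => e.endo.lift x - j) (Ioc a b)
      = ENNReal.ofReal (e.E (b + j) - e.E (a + j)) := by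
  rw [Measure.map_apply (e.endo.lift.continuous.measurable.sub_const _) measurableSet_Ioc,
    ← Real.volume_Ioc]
  congr 1
  ext x
  have h1 : e.E (a + j) < x ↔ a + j < e.endo.lift x := by
    conv_lhs => rw [← e.E_lift x]
    exact e.strictMono.lt_iff_lt
  have h2 : x ≤ e.E (b + j) ↔ e.endo.lift x ≤ b + j := by
    conv_lhs => rw [← e.E_lift x]
    exact e.strictMono.le_iff_le
  simp only [mem_preimage, mem_Ioc, h1, h2, lt_sub_iff_add_lt, sub_le_iff_le_add]

theorem sum_sub_eq (a b : ℝ) : ∑ j ∈ Finset.range d, (e.E (b + j) - e.E (a + j)) = b - a := by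
  have h1 := e.sum_eq a
  have h2 := e.sum_eq b
  rw [Finset.sum_sub_distrib] at h1 h2 ⊢
  linarith

/-- Invariance, lifted to the line: branch `j` gives `(a, b]` the mass `E (b + j) - E (a + j)`, and
these sum to `b - a`. -/
theorem sum_map_lift_sub :
    ∑ j ∈ Finset.range d, (volume : Measure ℝ).map (fun x => e.endo.lift x - j) = volume := by
  refine (Measure.ext_of_Ioc _ _ fun a b hab => ?_).symm
  rw [Measure.finsetSum_apply]
  simp only [e.volume_map_lift_sub]
  rw [← ENNReal.ofReal_sum_of_nonneg fun j _ => sub_nonneg.2 (e.strictMono.monotone (by linarith)),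
    e.sum_sub_eq, Real.volume_Ioc]

theorem lift_one : e.endo.lift 1 = d := by
  have := e.endo.map_add_one 0
  rwa [zero_add, e.endo.map_zero, zero_add] at this

theorem coe_sub_nat (x : ℝ) (j : ℕ) : ((x - j : ℝ) : UnitAddCircle) = (x : UnitAddCircle) := by
  have h : ((j : ℝ) : UnitAddCircle) = 0 :=
    (AddCircle.coe_eq_zero_iff (1 : ℝ)).2 ⟨(j : ℤ), by simp⟩
  rw [AddCircle.coe_sub, h, sub_zero]

theorem mem_Ioc_iff_exists (x : ℝ) :
    x ∈ Ioc (0 : ℝ) 1 ↔ ∃ j ∈ Finset.range d, e.endo.lift x - j ∈ Ioc (0 : ℝ) 1 := by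
  have h0 : 0 < x ↔ 0 < e.endo.lift x := by
    conv_rhs => rw [← e.endo.map_zero]
    exact e.endo.lift.lt_iff_lt.symm
  have h1 : x ≤ 1 ↔ e.endo.lift x ≤ d := by
    rw [← e.lift_one]
    exact e.endo.lift.le_iff_le.symm
  rw [mem_Ioc, h0, h1]
  constructor
  · rintro ⟨h, h'⟩
    have hc : 0 < ⌈e.endo.lift x⌉₊ := Nat.ceil_pos.2 h
    have hc' : ⌈e.endo.lift x⌉₊ ≤ d := Nat.ceil_le.2 h'
    -- Ceiling minus one replaces the floor because the fundamental domain `(0, 1]` is open on the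
    -- left.
    refine ⟨⌈e.endo.lift x⌉₊ - 1, Finset.mem_range.2 (by omega), ?_⟩
    have e1 : ((⌈e.endo.lift x⌉₊ - 1 : ℕ) : ℝ) = ⌈e.endo.lift x⌉₊ - 1 := by
      rw [Nat.cast_sub hc, Nat.cast_one]
    rw [e1]
    constructor
    · linarith [Nat.ceil_lt_add_one h.le]
    · linarith [Nat.le_ceil (e.endo.lift x)]
  · rintro ⟨j, hj, h, h'⟩
    have hj0 : (0 : ℝ) ≤ j := Nat.cast_nonneg j
    have hj1 : (j : ℝ) + 1 ≤ d := by exact_mod_cast Finset.mem_range.1 hj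
    constructor <;> linarith

theorem measurePreserving_toMap :
    MeasurePreserving e.endo.toMap (volume : Measure UnitAddCircle) volume := by
  refine ⟨e.endo.continuous_toMap.measurable, ?_⟩
  ext A hA
  have hF : ∀ j : ℕ, Measurable fun x => e.endo.lift x - j := fun j =>
    e.endo.lift.continuous.measurable.sub_const _
  have hA' : MeasurableSet (((↑) : ℝ → UnitAddCircle) ⁻¹' A ∩ Ioc 0 1) :=
    (AddCircle.measurable_mk' hA).inter measurableSet_Ioc
  have hpre : MeasurableSet (e.endo.toMap ⁻¹' A) := e.endo.continuous_toMap.measurable hA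
  rw [Measure.map_apply e.endo.continuous_toMap.measurable hA,
    AddCircle.add_projection_respects_measure 1 0 hpre,
    AddCircle.add_projection_respects_measure 1 0 hA, zero_add]
  have hset : (QuotientAddGroup.mk : ℝ → UnitAddCircle) ⁻¹' (e.endo.toMap ⁻¹' A) ∩ Ioc 0 1 =
      ⋃ j ∈ Finset.range d, (fun x => e.endo.lift x - j) ⁻¹'
        (((↑) : ℝ → UnitAddCircle) ⁻¹' A ∩ Ioc 0 1) := by
    ext x
    simp only [mem_inter_iff, mem_preimage, mem_iUnion, exists_prop, coe_sub_nat]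
    rw [e.mem_Ioc_iff_exists]
    change (e.endo.lift x : UnitAddCircle) ∈ A ∧ _ ↔ _
    constructor
    · rintro ⟨h, j, hj, h'⟩
      exact ⟨j, hj, h, h'⟩
    · rintro ⟨j, hj, h, h'⟩
      exact ⟨h, j, hj, h'⟩
  rw [hset, measure_biUnion_finset ?_ fun j _ => hF j hA']
  · conv_rhs => rw [← e.sum_map_lift_sub, Measure.finsetSum_apply]
    exact Finset.sum_congr rfl fun j _ => (Measure.map_apply (hF j) hA').symm
  · intro i _ j _ hij
    refine Set.disjoint_left.2 fun x hi hj => hij ?_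
    have h1 := hi.2
    have h2 := hj.2
    simp only [mem_Ioc] at h1 h2
    have h3 : (i : ℝ) < j + 1 := by linarith [h1.1, h2.2]
    have h4 : (j : ℝ) < i + 1 := by linarith [h1.2, h2.1]
    have h3' : i < j + 1 := by exact_mod_cast h3
    have h4' : j < i + 1 := by exact_mod_cast h4
    omega

end InverseLift

/-! ### Cylinders of the dual symbolic space -/

section Cylinders

variable {d : ℕ}

/-- The word `w` with the digit `j` appended at the end. -/
def appendDigit (j : Fin d) (w : DualSpace d) : DualSpace d
  | 0 => j
  | k + 1 => w k

theorem dualShift_appendDigit (j : Fin d) (w : DualSpace d) : dualShift (appendDigit j w) = w := rfl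

theorem appendDigit_dualShift (w : DualSpace d) : appendDigit (w 0) (dualShift w) = w := by
  funext k
  cases k <;> rfl

theorem continuous_dualShift : Continuous (dualShift : DualSpace d → DualSpace d) :=
  continuous_pi fun k => continuous_apply (k + 1)

theorem dualShift_iterate (n : ℕ) (w : DualSpace d) (k : ℕ) : dualShift^[n] w k = w (k + n) := by
  induction n generalizing w with
  | zero => rfl
  | succ n ih =>
    rw [Function.iterate_succ_apply, ih]
    rfl

theorem mem_cylinder_appendDigit {j : Fin d} {w v : DualSpace d} {n : ℕ} :
    v ∈ PiNat.cylinder (appendDigit j w) (n + 1) ↔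
      v 0 = j ∧ dualShift v ∈ PiNat.cylinder w n := by
  simp only [PiNat.mem_cylinder_iff]
  constructor
  · exact fun h => ⟨h 0 (by omega), fun i hi => h (i + 1) (by omega)⟩
  · rintro ⟨h0, h⟩ i hi
    cases i with
    | zero => exact h0
    | succ i => exact h i (by omega)

theorem image_cylinder_succ (w : DualSpace d) (n : ℕ) :
    dualShift '' PiNat.cylinder w (n + 1) = PiNat.cylinder (dualShift w) n := by
  ext v
  constructor
  · rintro ⟨u, hu, rfl⟩
    exact PiNat.mem_cylinder_iff.2 fun i hi => PiNat.mem_cylinder_iff.1 hu (i + 1) (by omega)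
  · intro hv
    refine ⟨appendDigit (w 0) v, ?_, rfl⟩
    rw [← appendDigit_dualShift w]
    exact mem_cylinder_appendDigit.2 ⟨rfl, hv⟩

theorem isClopen_cylinder (w : DualSpace d) (n : ℕ) : IsClopen (PiNat.cylinder w n) := by
  refine ⟨?_, PiNat.isOpen_cylinder _ w n⟩
  rw [PiNat.cylinder_eq_pi]
  exact isClosed_set_pi fun i _ => isClosed_discrete _

theorem measurableSet_cylinder (w : DualSpace d) (n : ℕ) : MeasurableSet (PiNat.cylinder w n) :=
  (isClopen_cylinder w n).isOpen.measurableSet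

theorem measureReal_preimage_cylinder (μ : Measure (DualSpace d)) [IsFiniteMeasure μ]
    (w : DualSpace d) (n : ℕ) :
    μ.real (dualShift ⁻¹' PiNat.cylinder w n) =
      ∑ j, μ.real (PiNat.cylinder (appendDigit j w) (n + 1)) := by
  have h : dualShift ⁻¹' PiNat.cylinder w n =
      ⋃ j ∈ (Finset.univ : Finset (Fin d)), PiNat.cylinder (appendDigit j w) (n + 1) := by
    ext v
    simp [mem_cylinder_appendDigit, -PiNat.mem_cylinder_iff]
  rw [h, measureReal_biUnion_finset]
  · intro i _ j _ hij
    refine Set.disjoint_left.2 fun v hi hj => hij ?_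
    rw [← (mem_cylinder_appendDigit.1 hi).1, ← (mem_cylinder_appendDigit.1 hj).1]
  · exact fun j _ => measurableSet_cylinder _ _

theorem measureReal_cylinder_eq_sum (μ : Measure (DualSpace d)) [IsFiniteMeasure μ]
    (w : DualSpace d) (n : ℕ) :
    μ.real (PiNat.cylinder w n) =
      ∑ j, μ.real (PiNat.cylinder (Function.update w n j) (n + 1)) := by
  rw [← measureReal_biUnion_finset]
  · simp only [Finset.mem_univ, iUnion_true]
    exact congrArg _ (PiNat.iUnion_cylinder_update w n).symm
  · intro i _ j _ hij
    refine Set.disjoint_left.2 fun v hi hj => hij ?_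
    have h1 := PiNat.mem_cylinder_iff.1 hi n (by omega)
    have h2 := PiNat.mem_cylinder_iff.1 hj n (by omega)
    rw [Function.update_self] at h1 h2
    rw [← h1, ← h2]
  · exact fun j _ => measurableSet_cylinder _ _

/-- A positive additive cylinder function is positive along the cylinders around some point. -/
theorem exists_pos_along (g : Set (DualSpace d) → ℝ)
    (hg : ∀ w n, g (PiNat.cylinder w n) =
      ∑ j, g (PiNat.cylinder (Function.update w n j) (n + 1)))
    {w : DualSpace d} {n : ℕ} (h : 0 < g (PiNat.cylinder w n)) :
    ∃ v, ∀ k, 0 < g (PiNat.cylinder v (n + k)) := by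
  have step : ∀ w n, 0 < g (PiNat.cylinder w n) →
      ∃ j, 0 < g (PiNat.cylinder (Function.update w n j) (n + 1)) := by
    intro w n h
    -- By additivity a positive cylinder has a positive child; the nested choices single out a
    -- point.
    by_contra! hcon
    rw [hg] at h
    exact absurd h (not_lt.2 (Finset.sum_nonpos fun j _ => hcon j))
  choose J hJ using step
  let s : (k : ℕ) → {v : DualSpace d // 0 < g (PiNat.cylinder v (n + k))} := fun k =>
    Nat.rec ⟨w, h⟩ (fun k v => ⟨_, hJ v.1 (n + k) v.2⟩) k
  let t : ℕ → DualSpace d := fun k => (s k).1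
  have ht : ∀ k, 0 < g (PiNat.cylinder (t k) (n + k)) := fun k => (s k).2
  have hs : ∀ k i, i < n + k → t (k + 1) i = t k i := fun k i hi =>
    Function.update_of_ne (by omega) _ _
  have hs' : ∀ k m i, i < n + k → t (k + m) i = t k i := by
    intro k m i hi
    induction m with
    | zero => rfl
    | succ m ih => rw [← add_assoc, hs _ _ (by omega), ih]
  -- Digit `i` no longer changes from stage `i + 1` on, so this diagonal word lies in all the chosen
  -- cylinders.
  refine ⟨fun i => t (i + 1) i, fun k => ?_⟩
  have : PiNat.cylinder (fun i => t (i + 1) i) (n + k) = PiNat.cylinder (t k) (n + k) := by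
    refine PiNat.mem_cylinder_iff_eq.1 (PiNat.mem_cylinder_iff.2 fun i hi => ?_)
    rw [← hs' (i + 1) k i (by omega), ← hs' k (i + 1) i hi, add_comm k]
  rw [this]
  exact ht k

/-- A finite measure on the dual symbolic space is determined by the cylinders. -/
theorem ext_of_cylinder {μ ν : Measure (DualSpace d)} [IsProbabilityMeasure μ]
    [IsProbabilityMeasure ν]
    (h : ∀ w n, μ.real (PiNat.cylinder w n) = ν.real (PiNat.cylinder w n)) : μ = ν := by
  refine ext_of_generate_finite {s | ∃ w n, s = PiNat.cylinder w n} ?_ ?_ ?_ (by simp)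
  · rw [← (PiNat.isTopologicalBasis_cylinders fun _ => Fin d).borel_eq_generateFrom]
    exact BorelSpace.measurable_eq
  · rintro _ ⟨w, n, rfl⟩ _ ⟨v, m, rfl⟩ ⟨x, hx, hx'⟩
    rw [PiNat.mem_cylinder_iff_eq] at hx hx'
    rw [← hx, ← hx']
    rcases le_total n m with h | h
    · exact ⟨x, m, inter_eq_right.2 (PiNat.cylinder_anti x h)⟩
    · exact ⟨x, n, inter_eq_left.2 (PiNat.cylinder_anti x h)⟩
  · rintro _ ⟨w, n, rfl⟩
    exact (measureReal_eq_measureReal_iff).1 (h w n)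

end Cylinders

/-! ### Interval lengths -/

section Intervals

variable {d : ℕ} (f : CircleEndo d)

theorem CircleEndo.branch_succ (w : DualSpace d) (n : ℕ) (x : ℝ) :
    f.branch w (n + 1) x = f.branch (dualShift w) n (f.lift.symm (x + (w 0 : ℕ))) := by
  induction n with
  | zero => rfl
  | succ n ih =>
    rw [CircleEndo.branch, ih]
    rfl

theorem CircleEndo.strictMono_branch (w : DualSpace d) (n : ℕ) : StrictMono (f.branch w n) := by
  induction n with
  | zero => exact strictMono_id
  | succ n ih => exact fun x y h => f.lift.symm.strictMono (add_lt_add_left (ih h) _)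

theorem CircleEndo.intervalLength_pos (w : DualSpace d) (n : ℕ) : 0 < f.intervalLength w n :=
  sub_pos.2 (f.strictMono_branch w n one_pos)

theorem CircleEndo.lift_symm_zero : f.lift.symm 0 = 0 := by
  rw [OrderIso.symm_apply_eq, f.map_zero]

theorem CircleEndo.lift_symm_degree : f.lift.symm d = 1 := by
  rw [OrderIso.symm_apply_eq]
  have := f.map_add_one 0
  rw [zero_add, f.map_zero, zero_add] at this
  exact this.symm

/-- The children tile the parent: their endpoints are the images of the points `F⁻¹ j` under its
branch, so the lengths telescope. -/
theorem CircleEndo.sum_intervalLength (w : DualSpace d) (n : ℕ) :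
    ∑ j, f.intervalLength (appendDigit j w) (n + 1) = f.intervalLength w n := by
  have h : ∀ j : Fin d, f.intervalLength (appendDigit j w) (n + 1) =
      f.branch w n (f.lift.symm ((j : ℕ) + 1 : ℕ)) - f.branch w n (f.lift.symm (j : ℕ)) := by
    intro j
    rw [CircleEndo.intervalLength, f.branch_succ, f.branch_succ, dualShift_appendDigit, zero_add,
      Nat.cast_add, Nat.cast_one, add_comm (1 : ℝ)]
    rfl
  simp only [h]
  rw [Fin.sum_univ_eq_sum_range (fun j : ℕ =>
      f.branch w n (f.lift.symm (j + 1 : ℕ)) - f.branch w n (f.lift.symm j)),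
    Finset.sum_range_sub (fun j : ℕ => f.branch w n (f.lift.symm j)), f.lift_symm_degree,
    Nat.cast_zero, f.lift_symm_zero, CircleEndo.intervalLength]

/-- The tiling identity, divided by the parent length, passes to the limit. This normalization is
all that invariance needs from the function model. -/
theorem CircleEndo.IsDualDerivative.sum_inv {f : CircleEndo d} {Ψ : DualSpace d → ℝ}
    (h : f.IsDualDerivative Ψ) (hpos : ∀ w, 0 < Ψ w) (w : DualSpace d) :
    ∑ j, (Ψ (appendDigit j w))⁻¹ = 1 := by
  have hlim := tendsto_finsetSum (Finset.univ : Finset (Fin d)) fun j _ =>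
    (h (appendDigit j w)).inv₀ (hpos _).ne'
  refine tendsto_nhds_unique (hlim.congr fun n => ?_) tendsto_const_nhds
  simp only [dualShift_appendDigit, inv_div]
  rw [← Finset.sum_div, f.sum_intervalLength, div_self (f.intervalLength_pos w n).ne']

/-! ### Invariance of dual geometric Gibbs type measures -/

theorem IsDualGeometricGibbs.cylinder_pos {Ψ : DualSpace d → ℝ} {μ : Measure (DualSpace d)}
    (hμ : IsDualGeometricGibbs Ψ μ) (w : DualSpace d) (n : ℕ) :
    0 < μ.real (PiNat.cylinder w n) := by
  have := hμ.isProbabilityMeasure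
  have := hμ.fullSupport
  exact ENNReal.toReal_pos ((isClopen_cylinder w n).isOpen.measure_pos μ
    ⟨w, PiNat.self_mem_cylinder w n⟩).ne' (measure_ne_top _ _)

/-- The preimage of a cylinder is the union of its one-digit extensions on the right, whose relative
masses tend to the `1 / Ψ` that sum to 1. -/
theorem IsDualGeometricGibbs.tendsto_ratio {Ψ : DualSpace d → ℝ} {μ : Measure (DualSpace d)}
    (hμ : IsDualGeometricGibbs Ψ μ) {f : CircleEndo d} (hf : f.IsDualDerivative Ψ)
    (w : DualSpace d) :
    Tendsto (fun n => μ.real (dualShift ⁻¹' PiNat.cylinder w n) / μ.real (PiNat.cylinder w n))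
      atTop (𝓝 1) := by
  have := hμ.isProbabilityMeasure
  have hlim := tendsto_finsetSum (Finset.univ : Finset (Fin d)) fun j _ =>
    ((hμ.deriv_eq (appendDigit j w)).comp (tendsto_add_atTop_nat 1)).inv₀ (hμ.pos _).ne'
  rw [hf.sum_inv hμ.pos] at hlim
  refine hlim.congr fun n => ?_
  simp only [Function.comp, image_cylinder_succ, dualShift_appendDigit, inv_div]
  rw [← Finset.sum_div, measureReal_preimage_cylinder]

/-- Differentiation with convergence at every point: let `ν` be the pushforward and `a + b < 0`. If
`a ν + b μ` were positive on a cylinder, it would be positive along cylinders shrinking to some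
point; dividing by `μ` there gives `a + b ≥ 0` in the limit. -/
theorem IsDualGeometricGibbs.measurePreserving {Ψ : DualSpace d → ℝ} {μ : Measure (DualSpace d)}
    (hμ : IsDualGeometricGibbs Ψ μ) {f : CircleEndo d} (hf : f.IsDualDerivative Ψ) :
    MeasurePreserving dualShift μ μ := by
  have := hμ.isProbabilityMeasure
  have hm : Measurable (dualShift : DualSpace d → DualSpace d) := continuous_dualShift.measurable
  have := Measure.isProbabilityMeasure_map (μ := μ) hm.aemeasurable
  have hmap : ∀ w n, (μ.map dualShift).real (PiNat.cylinder w n) =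
      μ.real (dualShift ⁻¹' PiNat.cylinder w n) := fun w n =>
    map_measureReal_apply hm (measurableSet_cylinder w n)
  have hadd : ∀ a b : ℝ, ∀ w n, a * (μ.map dualShift).real (PiNat.cylinder w n)
      + b * μ.real (PiNat.cylinder w n) =
      ∑ j, (a * (μ.map dualShift).real (PiNat.cylinder (Function.update w n j) (n + 1))
        + b * μ.real (PiNat.cylinder (Function.update w n j) (n + 1))) := by
    intro a b w n
    rw [Finset.sum_add_distrib, ← Finset.mul_sum, ← Finset.mul_sum,
      ← measureReal_cylinder_eq_sum, ← measureReal_cylinder_eq_sum]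
  have key : ∀ a b : ℝ, a + b < 0 → ∀ w n, a * (μ.map dualShift).real (PiNat.cylinder w n)
      + b * μ.real (PiNat.cylinder w n) ≤ 0 := by
    intro a b hab w n
    by_contra! hcon
    obtain ⟨v, hv⟩ := exists_pos_along
      (fun C => a * (μ.map dualShift).real C + b * μ.real C) (hadd a b) hcon
    have hlim := ((((hμ.tendsto_ratio hf v).comp (tendsto_add_atTop_nat n)).const_mul a).add_const
      b)
    rw [mul_one] at hlim
    refine absurd hab (not_lt.2 (ge_of_tendsto' hlim fun k => ?_))
    have hc := hμ.cylinder_pos v (n + k)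
    have := div_nonneg (hv k).le hc.le
    rw [add_div, mul_div_assoc, mul_div_cancel_right₀ _ hc.ne', hmap] at this
    simpa only [Function.comp, add_comm k] using this
  have key0 : ∀ a b : ℝ, a + b ≤ 0 → ∀ w n, a * (μ.map dualShift).real (PiNat.cylinder w n)
      + b * μ.real (PiNat.cylinder w n) ≤ 0 := by
    intro a b hab w n
    refine le_of_forall_pos_le_add fun ε hε => ?_
    -- Lowering `b` by `ε` makes the inequality strict and costs at most `ε`, since `μ ≤ 1`.
    have := key a (b - ε) (by linarith) w n
    have h1 : μ.real (PiNat.cylinder w n) ≤ 1 := measureReal_le_one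
    nlinarith [mul_le_mul_of_nonneg_left h1 hε.le]
  refine ⟨hm, ext_of_cylinder fun w n => ?_⟩
  have h1 := key0 1 (-1) (by norm_num) w n
  have h2 := key0 (-1) 1 (by norm_num) w n
  linarith

end Intervals

/-! ### Entropy of the dual shift -/

section DualEntropy

variable {d : ℕ}

theorem metricEntropy_dualShift_le {μ : Measure (DualSpace d)} [IsProbabilityMeasure μ]
    (h : MeasurePreserving dualShift μ μ) :
    metricEntropy dualShift μ ≤ ENNReal.ofReal (shannon μ fun w : DualSpace d => w 0) := by
  refine metricEntropy_le_shannon h (measurable_pi_apply 0) fun w v hwv => ?_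
  funext k
  have := congrFun hwv k
  simpa [dualShift_iterate] using this

theorem metricEntropy_dualShift_le_log {μ : Measure (DualSpace d)} [IsProbabilityMeasure μ]
    (h : MeasurePreserving dualShift μ μ) :
    metricEntropy dualShift μ ≤ ENNReal.ofReal (Real.log d) := by
  refine (metricEntropy_dualShift_le h).trans (ENNReal.ofReal_le_ofReal ?_)
  simpa using shannon_le_log_card μ (X := fun w : DualSpace d => w 0)
    (measurableSet_fiber_of_measurable (measurable_pi_apply 0))

/-- Under the uniform Bernoulli measure the last-digit partition already has join entropy `n log d`.
-/
theorem log_le_metricEntropy_dualShift (hd : 0 < d) {μ : Measure (DualSpace d)}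
    (h : ∀ w n, μ.real (PiNat.cylinder w n) = ((d : ℝ) ^ n)⁻¹) :
    ENNReal.ofReal (Real.log d) ≤ metricEntropy dualShift μ := by
  refine le_trans ?_ (le_iSup_of_le d (le_iSup_of_le (fun w : DualSpace d => w 0)
    (le_iSup_of_le (measurable_pi_apply 0) le_rfl)))
  have hj : ∀ n : ℕ, joinEntropy dualShift μ (fun w : DualSpace d => w 0) n = n * Real.log d := by
    intro n
    have hc : ∀ a : Fin n → Fin d,
        μ.real {x : DualSpace d | ∀ i : Fin n, (dualShift^[i] x) 0 = a i} = ((d : ℝ) ^ n)⁻¹ := by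
      intro a
      rw [← h (fun k => if hk : k < n then a ⟨k, hk⟩ else ⟨0, hd⟩) n]
      congr 1
      ext x
      simp only [mem_ofPred_eq, dualShift_iterate, zero_add, PiNat.mem_cylinder_iff]
      constructor
      · intro hx i hi
        rw [dif_pos hi]
        exact hx ⟨i, hi⟩
      · intro hx i
        have := hx i i.2
        rwa [dif_pos i.2] at this
    have hd0 : (d : ℝ) ≠ 0 := by positivity
    simp only [joinEntropy, hc, Finset.sum_const, Finset.card_univ, Fintype.card_pi,
      Fintype.card_fin, Finset.prod_const, nsmul_eq_mul, Real.negMulLog, Real.log_inv,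
      Real.log_pow]
    push_cast
    field_simp
  rw [partitionEntropy]
  have : Tendsto (fun n : ℕ => ENNReal.ofReal
      (joinEntropy dualShift μ (fun w : DualSpace d => w 0) n / n)) atTop
      (𝓝 (ENNReal.ofReal (Real.log d))) := by
    refine tendsto_const_nhds.congr' ?_
    filter_upwards [eventually_gt_atTop 0] with n hn
    have hn0 : (n : ℝ) ≠ 0 := by positivity
    rw [hj, mul_div_cancel_left₀ _ hn0]
  exact this.limsup_eq.ge

end DualEntropy

/-! ### Fundamental domain of the circle -/

instance isProbabilityMeasure_circle : IsProbabilityMeasure (volume : Measure UnitAddCircle) :=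
  ⟨by simp⟩

/-- The representative in `[0, 1)` of a point of the circle. -/
def rep (z : UnitAddCircle) : ℝ := (AddCircle.equivIco 1 0 z : ℝ)

theorem rep_mem (z : UnitAddCircle) : rep z ∈ Ico (0 : ℝ) 1 := by
  have h : rep z ∈ Ico (0 : ℝ) (0 + 1) := (AddCircle.equivIco 1 0 z).2
  rwa [zero_add] at h

theorem coe_rep (z : UnitAddCircle) : (rep z : UnitAddCircle) = z := AddCircle.coe_equivIco

theorem rep_coe {x : ℝ} (hx : x ∈ Ico (0 : ℝ) 1) : rep (x : UnitAddCircle) = x := by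
  rw [rep, AddCircle.equivIco_coe_eq (by rwa [zero_add])]

theorem measurable_rep : Measurable rep :=
  measurable_subtype_coe.comp (AddCircle.measurableEquivIco 1 0).measurable

theorem map_rep : (volume : Measure UnitAddCircle).map rep = volume.restrict (Ico (0 : ℝ) 1) := by
  have h := (AddCircle.measurePreserving_mk 1 0).map_eq
  rw [zero_add] at h
  rw [← h, Measure.map_map measurable_rep AddCircle.measurable_mk',
    ← Measure.restrict_congr_set (μ := (volume : Measure ℝ)) Ico_ae_eq_Ioc]
  have : rep ∘ ((↑) : ℝ → UnitAddCircle) =ᵐ[volume.restrict (Ico (0 : ℝ) 1)] id := by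
    filter_upwards [ae_restrict_mem measurableSet_Ico] with x hx
    exact rep_coe hx
  rw [Measure.map_congr this, Measure.map_id]

theorem volume_rep_preimage_Ico {a b : ℝ} (ha : 0 ≤ a) (hb : b ≤ 1) :
    volume (rep ⁻¹' Ico a b) = ENNReal.ofReal (b - a) := by
  rw [← Measure.map_apply measurable_rep measurableSet_Ico, map_rep,
    Measure.restrict_apply measurableSet_Ico,
    inter_eq_left.2 (Ico_subset_Ico ha hb), Real.volume_Ico]

/-- The distribution function is the identity. -/
theorem isSymmetricMeasure_volume : IsSymmetricMeasure (volume : Measure UnitAddCircle) := by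
  refine ⟨⟨OrderIso.refl ℝ, fun x => rfl, by simp⟩, isSymmetric_id, fun x hx => ?_⟩
  have hset : (fun y : ℝ => (y : UnitAddCircle)) '' Icc 0 x = rep ⁻¹' Icc 0 x := by
    ext z
    constructor
    · rintro ⟨y, hy, rfl⟩
      rw [mem_preimage, rep_coe ⟨hy.1, hy.2.trans_lt hx.2⟩]
      exact hy
    · exact fun hz => ⟨rep z, hz, coe_rep z⟩
  rw [hset, measureReal_def, ← Measure.map_apply measurable_rep measurableSet_Icc, map_rep,
    Measure.restrict_apply measurableSet_Icc,
    inter_eq_left.2 fun y (hy : y ∈ Icc 0 x) => mem_Ico.2 ⟨hy.1, hy.2.trans_lt hx.2⟩, Real.volume_Icc, sub_zero,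
    ENNReal.toReal_ofReal hx.1]
  rfl

namespace InverseLift

variable {d : ℕ} (e : InverseLift d)

/-! ### The Markov partition of the circle -/

theorem lift_rep_mem (z : UnitAddCircle) : e.endo.lift (rep z) ∈ Ico (0 : ℝ) d := by
  constructor
  · rw [← e.endo.map_zero]
    exact e.endo.lift.monotone (rep_mem z).1
  · rw [← e.lift_one]
    exact e.endo.lift.strictMono (rep_mem z).2

/-- The label of the Markov interval of level one that contains a point. -/
def label (z : UnitAddCircle) : Fin d :=
  ⟨⌊e.endo.lift (rep z)⌋₊, (Nat.floor_lt (e.lift_rep_mem z).1).2 (e.lift_rep_mem z).2⟩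

theorem measurable_label : Measurable e.label := by
  refine measurable_to_countable' fun j => ?_
  have : e.label ⁻¹' {j} = (fun z => ⌊e.endo.lift (rep z)⌋₊) ⁻¹' {(j : ℕ)} := by
    ext z
    simp [label, Fin.ext_iff]
  rw [this]
  exact (Nat.measurable_floor.comp (e.endo.lift.continuous.measurable.comp measurable_rep))
    (measurableSet_singleton _)

theorem label_eq_iff (z : UnitAddCircle) (j : Fin d) :
    e.label z = j ↔ e.endo.lift (rep z) ∈ Ico (j : ℝ) (j + 1) := by
  rw [label, Fin.ext_iff, Nat.floor_eq_iff (e.lift_rep_mem z).1]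
  rfl

theorem rep_toMap (z : UnitAddCircle) :
    rep (e.endo.toMap z) = e.endo.lift (rep z) - (e.label z : ℕ) := by
  have h := (e.label_eq_iff z _).1 rfl
  conv_lhs => rw [← coe_rep z, CircleEndo.toMap_coe, ← coe_sub_nat _ (e.label z : ℕ)]
  exact rep_coe ⟨by linarith [h.1], by linarith [h.2]⟩

theorem rep_eq (z : UnitAddCircle) : rep z = e.E (rep (e.endo.toMap z) + (e.label z : ℕ)) := by
  rw [rep_toMap, sub_add_cancel, e.E_lift]

/-- Points with equal itineraries are images, under the same `n` inverse branches, of points at most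
1 apart; so they are within `l ^ n` for every `n`. -/
theorem injective_itinerary :
    Function.Injective fun z (n : ℕ) => e.label (e.endo.toMap^[n] z) := by
  intro z z' h
  have key : ∀ n : ℕ, ∀ z z' : UnitAddCircle,
      (∀ k, e.label (e.endo.toMap^[k] z) = e.label (e.endo.toMap^[k] z')) →
      |rep z - rep z'| ≤ e.l ^ n := by
    intro n
    induction n with
    | zero =>
      intro z z' _
      have h1 := rep_mem z
      have h2 := rep_mem z'
      rw [pow_zero, abs_le]
      constructor <;> linarith [h1.1, h1.2, h2.1, h2.2]
    | succ n ih =>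
      intro z z' hz
      have h1 := ih (e.endo.toMap z) (e.endo.toMap z') fun k => hz (k + 1)
      have hl := hz 0
      simp only [Function.iterate_zero, id] at hl
      have hE : ∀ x y, |e.E x - e.E y| ≤ e.l * |x - y| := by
        intro x y
        wlog hxy : y ≤ x generalizing x y
        · rw [abs_sub_comm, abs_sub_comm x]
          exact this y x (le_of_not_ge hxy)
        rw [abs_of_nonneg (sub_nonneg.2 hxy),
          abs_of_nonneg (sub_nonneg.2 (e.strictMono.monotone hxy))]
        exact e.E_sub_le hxy
      rw [e.rep_eq z, e.rep_eq z', hl, pow_succ']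
      refine (hE _ _).trans (mul_le_mul_of_nonneg_left ?_ e.l_pos.le)
      rwa [add_sub_add_right_eq_sub]
  have h0 : |rep z - rep z'| ≤ 0 :=
    ge_of_tendsto' (tendsto_pow_atTop_nhds_zero_of_lt_one e.l_pos.le e.l_lt_one) fun n =>
      key n z z' (congrFun h)
  have h1 := abs_nonpos_iff.1 h0
  rw [← coe_rep z, ← coe_rep z', sub_eq_zero.1 h1]

theorem branch_mem (w : DualSpace d) (n : ℕ) {x : ℝ} (hx : x ∈ Icc (0 : ℝ) 1) :
    e.endo.branch w n x ∈ Icc (0 : ℝ) 1 := by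
  induction n with
  | zero => exact hx
  | succ n ih =>
    have hj : ((w n : ℕ) : ℝ) + 1 ≤ d := by exact_mod_cast (w n).2
    constructor
    · rw [← e.endo.lift_symm_zero]
      exact e.endo.lift.symm.monotone (add_nonneg ih.1 (Nat.cast_nonneg _))
    · rw [← e.endo.lift_symm_degree]
      exact e.endo.lift.symm.monotone (by linarith [ih.2])

theorem branch_succ_eq (w : DualSpace d) (n : ℕ) (x : ℝ) :
    e.endo.branch w (n + 1) x = e.E (e.endo.branch w n x + (w n : ℕ)) := rfl

/-- Time is reversed: the outermost branch carries digit `n - 1`, which is the label at time 0. -/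
theorem itinerary_iff (w : DualSpace d) (n : ℕ) (z : UnitAddCircle) :
    (∀ k < n, e.label (e.endo.toMap^[n - 1 - k] z) = w k) ↔
      rep z ∈ Ico (e.endo.branch w n 0) (e.endo.branch w n 1) := by
  induction n generalizing z with
  | zero => simpa using! rep_mem z
  | succ n ih =>
    have h1 : (∀ k < n + 1, e.label (e.endo.toMap^[n + 1 - 1 - k] z) = w k) ↔
        e.label z = w n ∧
          ∀ k < n, e.label (e.endo.toMap^[n - 1 - k] (e.endo.toMap z)) = w k := by
      constructor
      · intro h
        refine ⟨by simpa using h n (by omega), fun k hk => ?_⟩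
        rw [← Function.iterate_succ_apply, ← h k (by omega)]
        congr 3
        omega
      · rintro ⟨h0, h⟩ k hk
        rcases (Nat.lt_succ_iff.1 hk).eq_or_lt with rfl | hk'
        · simpa using h0
        · rw [← h k hk', ← Function.iterate_succ_apply]
          congr 3
          omega
    rw [h1, ih]
    have h0 := e.branch_mem w n (x := 0) (by simp)
    have h2 := e.branch_mem w n (x := 1) (by simp)
    rw [branch_succ_eq, branch_succ_eq]
    have hz : rep z ∈ Ico (e.E (e.endo.branch w n 0 + (w n : ℕ)))
        (e.E (e.endo.branch w n 1 + (w n : ℕ))) ↔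
        e.endo.lift (rep z) ∈ Ico (e.endo.branch w n 0 + (w n : ℕ))
          (e.endo.branch w n 1 + (w n : ℕ)) := by
      conv_lhs => rw [← e.E_lift (rep z)]
      rw [mem_Ico, mem_Ico, e.strictMono.le_iff_le, e.strictMono.lt_iff_lt]
    rw [hz]
    constructor
    · rintro ⟨hl, h⟩
      rw [rep_toMap, hl] at h
      exact ⟨by linarith [h.1], by linarith [h.2]⟩
    · intro h
      have hl : e.label z = w n :=
        (e.label_eq_iff z _).2 ⟨by linarith [h.1, h0.1], by linarith [h.2, h2.2]⟩
      refine ⟨hl, ?_⟩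
      rw [rep_toMap, hl]
      exact ⟨by linarith [h.1], by linarith [h.2]⟩

theorem volume_itinerary (w : DualSpace d) (n : ℕ) :
    volume {z | ∀ k < n, e.label (e.endo.toMap^[n - 1 - k] z) = w k} =
      ENNReal.ofReal (e.endo.intervalLength w n) := by
  simp only [e.itinerary_iff]
  exact volume_rep_preimage_Ico (e.branch_mem w n (by simp)).1 (e.branch_mem w n (by simp)).2

theorem metricEntropy_volume_le :
    metricEntropy e.endo.toMap (volume : Measure UnitAddCircle) ≤
      ENNReal.ofReal (shannon (volume : Measure UnitAddCircle) e.label) :=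
  metricEntropy_le_shannon e.measurePreserving_toMap e.measurable_label e.injective_itinerary

/-! ### The dual measure -/

/-- The reversed itinerary of length `n`. -/
def reversedItinerary (n : ℕ) (z : UnitAddCircle) : DualSpace d :=
  -- For `k ≥ n` the truncated subtraction returns the label of `z`; only the first `n` digits are
  -- meaningful.
  fun k => e.label (e.endo.toMap^[n - 1 - k] z)

theorem measurable_reversedItinerary (n : ℕ) : Measurable (e.reversedItinerary n) :=
  measurable_pi_lambda _ fun _ =>
    e.measurable_label.comp (e.endo.continuous_toMap.measurable.iterate _)

/-- The first `m` reversed digits depend only on the image at time `n - m`, so invariance of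
Lebesgue measure makes their law independent of `n`. -/
theorem map_reversedItinerary (w : DualSpace d) {m n : ℕ} (h : m ≤ n) :
    (volume : Measure UnitAddCircle).map (e.reversedItinerary n) (PiNat.cylinder w m) =
      ENNReal.ofReal (e.endo.intervalLength w m) := by
  rw [Measure.map_apply (e.measurable_reversedItinerary n) (measurableSet_cylinder w m),
    ← e.volume_itinerary]
  have hs : e.reversedItinerary n ⁻¹' PiNat.cylinder w m = e.endo.toMap^[n - m] ⁻¹'
      {z | ∀ k < m, e.label (e.endo.toMap^[m - 1 - k] z) = w k} := by
    ext z
    simp only [mem_preimage, PiNat.mem_cylinder_iff, reversedItinerary, mem_ofPred_eq,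
      ← Function.iterate_add_apply]
    refine forall₂_congr fun k hk => ?_
    rw [show m - 1 - k + (n - m) = n - 1 - k by omega]
  rw [hs, (e.measurePreserving_toMap.iterate _).measure_preimage]
  refine MeasurableSet.nullMeasurableSet ?_
  simp only [e.itinerary_iff]
  exact measurable_rep measurableSet_Ico

/-- The measure on the dual symbolic space that gives each cylinder the length of the
corresponding Markov interval. -/
theorem exists_dualMeasure : ∃ μ : Measure (DualSpace d), IsProbabilityMeasure μ ∧
    ∀ w n, μ.real (PiNat.cylinder w n) = e.endo.intervalLength w n := by
  let ν : ℕ → ProbabilityMeasure (DualSpace d) := fun n =>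
    ⟨volume.map (e.reversedItinerary n),
      Measure.isProbabilityMeasure_map (e.measurable_reversedItinerary n).aemeasurable⟩
  -- Compactness of the space of probability measures gives a weak limit along a nonprincipal
  -- ultrafilter. Cylinders are clopen, so their eventually constant masses survive.
  let U : Ultrafilter (ProbabilityMeasure (DualSpace d)) := (hyperfilter ℕ).map ν
  have hU : Tendsto ν (hyperfilter ℕ) (𝓝 U.lim) := U.le_nhds_lim
  refine ⟨U.lim, inferInstance, fun w n => ?_⟩
  have hfr : (U.lim : Measure (DualSpace d)) (frontier (PiNat.cylinder w n)) = 0 := by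
    rw [(isClopen_cylinder w n).frontier_eq, measure_empty]
  have h1 := ProbabilityMeasure.tendsto_measure_of_null_frontier_of_tendsto' hU hfr
  have h2 : ∀ᶠ i in (hyperfilter ℕ : Filter ℕ), ENNReal.ofReal (e.endo.intervalLength w n)
      = (ν i : Measure (DualSpace d)) (PiNat.cylinder w n) := by
    have : ∀ᶠ i in (hyperfilter ℕ : Filter ℕ), n ≤ i :=
      (Nat.hyperfilter_le_atTop) (eventually_ge_atTop n)
    filter_upwards [this] with i hi
    exact (e.map_reversedItinerary w hi).symm
  have h3 := tendsto_nhds_unique h1 (tendsto_const_nhds.congr' h2)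
  rw [measureReal_def, h3, ENNReal.toReal_ofReal (e.endo.intervalLength_pos w n).le]

/-! ### The dual derivative -/

theorem intervalLength_le (w : DualSpace d) (n : ℕ) : e.endo.intervalLength w n ≤ e.l ^ n := by
  induction n with
  | zero => simp [CircleEndo.intervalLength, CircleEndo.branch]
  | succ n ih =>
    rw [CircleEndo.intervalLength, branch_succ_eq, branch_succ_eq, pow_succ']
    refine (e.E_sub_le (add_le_add_left
      ((e.endo.strictMono_branch w n).monotone zero_le_one) _)).trans
      (mul_le_mul_of_nonneg_left ?_ e.l_pos.le)
    rw [add_sub_add_right_eq_sub]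
    exact ih

theorem continuous_branch (n : ℕ) (x : ℝ) :
    Continuous fun w : DualSpace d => e.endo.branch w n x := by
  induction n with
  | zero => exact continuous_const
  | succ n ih =>
    refine e.continuous_E.comp (ih.add ?_)
    exact (continuous_of_discreteTopology (f := fun j : Fin d => ((j : ℕ) : ℝ))).comp
      (continuous_apply n)

/-- The logarithms of the ratios whose limit is the dual derivative. -/
def logRatio (n : ℕ) (w : DualSpace d) : ℝ :=
  Real.log (e.endo.intervalLength (dualShift w) n) - Real.log (e.endo.intervalLength w (n + 1))

theorem continuous_logRatio (n : ℕ) : Continuous (e.logRatio n) := by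
  have h : ∀ n, Continuous fun w : DualSpace d => Real.log (e.endo.intervalLength w n) := fun n =>
    ((e.continuous_branch n 1).sub (e.continuous_branch n 0)).log fun w =>
      (e.endo.intervalLength_pos w n).ne'
  exact ((h n).comp continuous_dualShift).sub (h (n + 1))

/-- One more `E` acts on both intervals after the same translation, and one contains the other; the
log ratio changes by `log ρ ξ - log ρ η` with `ξ`, `η` in an interval of length at most `l ^ n`. -/
theorem abs_logRatio_sub_le (n : ℕ) (w : DualSpace d) :
    ‖e.logRatio (n + 1) w - e.logRatio n w‖ ≤ e.K / e.c * e.l ^ n := by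
  have hE0 : e.E (0 + (w 0 : ℕ)) ∈ Icc (0 : ℝ) 1 := e.branch_mem w 1 (x := 0) (by simp)
  have hE1 : e.E (1 + (w 0 : ℕ)) ∈ Icc (0 : ℝ) 1 := e.branch_mem w 1 (x := 1) (by simp)
  have hbr : ∀ x, e.endo.branch w (n + 1) x =
      e.endo.branch (dualShift w) n (e.E (x + (w 0 : ℕ))) := fun x => e.endo.branch_succ w n x
  have hmono := (e.endo.strictMono_branch (dualShift w) n)
  let j : ℝ := ((w (n + 1) : ℕ) : ℝ)
  obtain ⟨ξ, hξ, h1⟩ := e.exists_slope (add_lt_add_left (hmono one_pos) j)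
  obtain ⟨η, hη, h2⟩ := e.exists_slope
    (add_lt_add_left ((e.endo.strictMono_branch w (n + 1)) one_pos) j)
  have e1 : e.endo.intervalLength (dualShift w) (n + 1) =
      e.ρ ξ * e.endo.intervalLength (dualShift w) n := by
    rw [add_sub_add_right_eq_sub] at h1
    exact h1
  have e2 : e.endo.intervalLength w (n + 1 + 1) = e.ρ η * e.endo.intervalLength w (n + 1) := by
    rw [add_sub_add_right_eq_sub] at h2
    exact h2
  have hlen := e.intervalLength_le (dualShift w) n
  rw [CircleEndo.intervalLength] at hlen
  have hd : |ξ - η| ≤ e.l ^ n := by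
    rw [hbr, hbr] at hη
    have h3 := hmono.monotone hE0.1
    have h4 := hmono.monotone hE1.2
    rw [abs_le]
    constructor <;> linarith [hξ.1, hξ.2, hη.1, hη.2]
  rw [logRatio, logRatio, e1, e2,
    Real.log_mul (e.ρ_pos ξ).ne' (e.endo.intervalLength_pos _ _).ne',
    Real.log_mul (e.ρ_pos η).ne' (e.endo.intervalLength_pos _ _).ne', Real.norm_eq_abs]
  calc _ = |Real.log (e.ρ ξ) - Real.log (e.ρ η)| := by congr 1; ring
    _ ≤ e.K / e.c * |ξ - η| := e.abs_log_ρ_sub_le ξ η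
    _ ≤ _ := mul_le_mul_of_nonneg_left hd (div_nonneg e.K_nonneg e.c_pos.le)

/-- The logarithm of the dual derivative. -/
def logDual (w : DualSpace d) : ℝ :=
  e.logRatio 0 w + ∑' n, (e.logRatio (n + 1) w - e.logRatio n w)

theorem summable_bound : Summable fun n : ℕ => e.K / e.c * e.l ^ n :=
  (summable_geometric_of_lt_one e.l_pos.le e.l_lt_one).mul_left _

theorem continuous_logDual : Continuous e.logDual :=
  (e.continuous_logRatio 0).add (continuous_tsum
    (fun n => (e.continuous_logRatio (n + 1)).sub (e.continuous_logRatio n)) e.summable_bound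
    e.abs_logRatio_sub_le)

theorem isDualDerivative : e.endo.IsDualDerivative fun w => Real.exp (e.logDual w) := by
  intro w
  have h := ((Summable.of_norm_bounded e.summable_bound
    fun n => e.abs_logRatio_sub_le n w).hasSum.tendsto_sum_nat).const_add (e.logRatio 0 w)
  refine ((Real.continuous_exp.tendsto _).comp h).congr fun n => ?_
  simp only [Function.comp]
  rw [Finset.sum_range_sub (fun n => e.logRatio n w), add_sub_cancel, logRatio, Real.exp_sub,
    Real.exp_log (e.endo.intervalLength_pos _ _), Real.exp_log (e.endo.intervalLength_pos _ _)]

/-- With interval lengths as masses, the Gibbs condition is the dual derivative with a shifted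
index; contraction excludes atoms and positive lengths give full support. -/
theorem isDualGeometricGibbs {μ : Measure (DualSpace d)} [IsProbabilityMeasure μ]
    (hμ : ∀ w n, μ.real (PiNat.cylinder w n) = e.endo.intervalLength w n) :
    IsDualGeometricGibbs (fun w => Real.exp (e.logDual w)) μ where
  pos w := Real.exp_pos _
  continuous := Real.continuous_exp.comp e.continuous_logDual
  isProbabilityMeasure := inferInstance
  noAtoms w := by
    rw [← measureReal_eq_zero_iff]
    refine le_antisymm ?_ measureReal_nonneg
    refine ge_of_tendsto' (tendsto_pow_atTop_nhds_zero_of_lt_one e.l_pos.le e.l_lt_one)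
      fun n => ?_
    refine le_trans ?_ (e.intervalLength_le w n)
    rw [← hμ]
    exact measureReal_mono (singleton_subset_iff.2 (PiNat.self_mem_cylinder w n))
  fullSupport := by
    refine ⟨fun U hU ⟨w, hw⟩ h0 => ?_⟩
    obtain ⟨_, ⟨v, n, rfl⟩, -, hsub⟩ :=
      (PiNat.isTopologicalBasis_cylinders fun _ => Fin d).exists_subset_of_mem_open hw hU
    have h1 := e.endo.intervalLength_pos v n
    rw [← hμ, measureReal_def, measure_mono_null hsub h0] at h1
    exact lt_irrefl _ h1
  deriv_eq w := by
    rw [← tendsto_add_atTop_iff_nat 1]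
    refine (e.isDualDerivative w).congr fun n => ?_
    rw [image_cylinder_succ, hμ, hμ]

/-! ### Entropy values -/

theorem intervalLength_const_one (j : Fin d) :
    e.endo.intervalLength (fun _ => j) 1 = e.E (1 + (j : ℕ)) - e.E (0 + (j : ℕ)) := rfl

theorem measureReal_label (j : Fin d) :
    (volume : Measure UnitAddCircle).real (e.label ⁻¹' {j}) =
      e.endo.intervalLength (fun _ => j) 1 := by
  have h := e.volume_itinerary (fun _ => j) 1
  rw [measureReal_def, ← ENNReal.toReal_ofReal (e.endo.intervalLength_pos (fun _ => j) 1).le, ← h]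
  congr 2
  ext z
  simp

theorem measureReal_zero_digit {μ : Measure (DualSpace d)}
    (hμ : ∀ w n, μ.real (PiNat.cylinder w n) = e.endo.intervalLength w n) (j : Fin d) :
    μ.real ((fun w : DualSpace d => w 0) ⁻¹' {j}) = e.endo.intervalLength (fun _ => j) 1 := by
  rw [← hμ]
  congr 1
  ext w
  simp

end InverseLift

/-! ### Extremal entropy values -/

theorem exists_inverseLift_entropy_lt (d : ℕ) (hd : 2 ≤ d) {ε : ℝ} (hε : 0 < ε) :
    ∃ e : InverseLift d, shannon (volume : Measure UnitAddCircle) e.label < ε ∧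
      ∀ μ : Measure (DualSpace d), IsProbabilityMeasure μ →
        (∀ w n, μ.real (PiNat.cylinder w n) = e.endo.intervalLength w n) →
          shannon μ (fun w : DualSpace d => w 0) < ε := by
  let last : Fin d := ⟨d - 1, by omega⟩
  -- The threshold concerns probability vectors only, so it serves both the Markov partition of the
  -- circle and the digit partition of the dual space.
  obtain ⟨δ, hδ, H⟩ := exists_delta_entropy_lt last hε
  obtain ⟨e, he⟩ := exists_inverseLift_long d hd hδ
  have hl : 1 - δ ≤ e.endo.intervalLength (fun _ => last) 1 := by
    have hc : ((d - 1 : ℕ) : ℝ) = d - 1 := by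
      rw [Nat.cast_sub (by omega), Nat.cast_one]
    rw [e.intervalLength_const_one, hc, zero_add, add_sub_cancel]
    exact he
  refine ⟨e, H _ (fun _ => measureReal_nonneg) ?_ ?_, fun μ _ hμ =>
    H _ (fun _ => measureReal_nonneg) ?_ ?_⟩
  · simpa using sum_measureReal_inter (volume : Measure UnitAddCircle)
      (measurableSet_fiber_of_measurable e.measurable_label) univ
  · rwa [e.measureReal_label]
  · simpa using sum_measureReal_inter μ (Y := fun w : DualSpace d => w 0)
      (measurableSet_fiber_of_measurable (measurable_pi_apply 0)) univ
  · rwa [e.measureReal_zero_digit hμ]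

theorem intervalLength_linear (d : ℕ) (hd : 2 ≤ d) (w : DualSpace d) (n : ℕ) :
    (InverseLift.linear d hd).endo.intervalLength w n = ((d : ℝ) ^ n)⁻¹ := by
  induction n with
  | zero => simp [CircleEndo.intervalLength, CircleEndo.branch]
  | succ n ih =>
    rw [CircleEndo.intervalLength, InverseLift.branch_succ_eq, InverseLift.branch_succ_eq]
    change (_ + _) / (d : ℝ) - (_ + _) / (d : ℝ) = _
    rw [← sub_div, add_sub_add_right_eq_sub, pow_succ, mul_inv, ← ih]
    rfl

theorem mem_dualEntropies {d : ℕ} (hd : 2 ≤ d) (e : InverseLift d) {μ : Measure (DualSpace d)}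
    [IsProbabilityMeasure μ]
    (hμ : ∀ w n, μ.real (PiNat.cylinder w n) = e.endo.intervalLength w n) :
    metricEntropy dualShift μ ∈ dualEntropies d :=
  ⟨_, ⟨e.marked hd, rfl⟩, _, ⟨_, e.mem_class hd, e.isDualDerivative⟩, μ,
    e.isDualGeometricGibbs hμ, rfl⟩

theorem isGLB_zero_of_exists_lt {S : Set ℝ≥0∞}
    (h : ∀ ε > (0 : ℝ), ∃ x ∈ S, x ≤ ENNReal.ofReal ε) : IsGLB S 0 := by
  refine ⟨fun _ _ => zero_le, fun b hb => ?_⟩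
  have hlim : Tendsto (fun ε : ℝ => ENNReal.ofReal ε) (𝓝[>] 0) (𝓝 0) := by
    have := (ENNReal.continuous_ofReal.tendsto 0).mono_left (nhdsWithin_le_nhds (s := Ioi 0))
    rwa [ENNReal.ofReal_zero] at this
  refine ge_of_tendsto hlim (eventually_mem_nhdsWithin.mono fun ε hε => ?_)
  obtain ⟨x, hx, hxε⟩ := h ε hε
  exact (hb hx).trans hxε

theorem isGLB_geometricEntropies (d : ℕ) (hd : 2 ≤ d) : IsGLB (geometricEntropies d) 0 := by
  refine isGLB_zero_of_exists_lt fun ε hε => ?_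
  obtain ⟨e, he, -⟩ := exists_inverseLift_entropy_lt d hd hε
  exact ⟨_, ⟨_, ⟨e.marked hd, rfl⟩, _, e.mem_class hd, volume, inferInstance,
    isSymmetricMeasure_volume, e.measurePreserving_toMap, rfl⟩,
    e.metricEntropy_volume_le.trans (ENNReal.ofReal_le_ofReal he.le)⟩

/-- The linear map attains the maximum. For every other Gibbs measure invariance comes first, since
the generator bound requires it. -/
theorem isGreatest_dualEntropies (d : ℕ) (hd : 2 ≤ d) :
    IsGreatest (dualEntropies d) (ENNReal.ofReal (Real.log d)) := by
  constructor
  · obtain ⟨μ, hp, hμ⟩ := (InverseLift.linear d hd).exists_dualMeasure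
    have hG := (InverseLift.linear d hd).isDualGeometricGibbs hμ
    have hinv := hG.measurePreserving (InverseLift.linear d hd).isDualDerivative
    rw [le_antisymm (log_le_metricEntropy_dualShift (by omega) fun w n => by
      rw [hμ, intervalLength_linear]) (metricEntropy_dualShift_le_log hinv)]
    exact mem_dualEntropies hd _ hμ
  · rintro _ ⟨τ, -, Ψ, ⟨p, -, hp⟩, μ, hμ, rfl⟩
    have := hμ.isProbabilityMeasure
    exact metricEntropy_dualShift_le_log (hμ.measurePreserving hp)

theorem isGLB_dualEntropies (d : ℕ) (hd : 2 ≤ d) : IsGLB (dualEntropies d) 0 := by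
  refine isGLB_zero_of_exists_lt fun ε hε => ?_
  obtain ⟨e, -, he⟩ := exists_inverseLift_entropy_lt d hd hε
  obtain ⟨μ, hp, hμ⟩ := e.exists_dualMeasure
  have hinv := (e.isDualGeometricGibbs hμ).measurePreserving e.isDualDerivative
  exact ⟨_, mem_dualEntropies hd e hμ,
    (metricEntropy_dualShift_le hinv).trans (ENNReal.ofReal_le_ofReal (he μ hp hμ).le)⟩

theorem exists_family_entropy_tendsto_zero {α : ℝ≥0} (hα : α ≤ 1) :
    ∃ f : ℝ → CircleEndo 2,
      (∀ s ∈ Ioo (0 : ℝ) 1, (f s).IsC1Holder α ∧ (f s).IsExpanding ∧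
        MeasurePreserving (f s).toMap (volume : Measure UnitAddCircle) volume) ∧
      Tendsto (fun s => metricEntropy (f s).toMap (volume : Measure UnitAddCircle))
        (𝓝[<] 1) (𝓝 0) := by
  -- The maps are chosen separately for each `s`, with entropy below `1 - s`; no regularity in `s`
  -- is claimed, and the linear map is a default for `s ≥ 1`.
  have h : ∀ s : ℝ, ∃ e : InverseLift 2,
      s < 1 → shannon (volume : Measure UnitAddCircle) e.label < 1 - s := by
    intro s
    by_cases hs : s < 1
    · obtain ⟨e, he, -⟩ := exists_inverseLift_entropy_lt 2 le_rfl (sub_pos.2 hs)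
      exact ⟨e, fun _ => he⟩
    · exact ⟨InverseLift.linear 2 le_rfl, fun h => absurd h hs⟩
  choose e he using h
  refine ⟨fun s => (e s).endo, fun s _ => ⟨(e s).isC1Holder hα, (e s).isExpanding,
    (e s).measurePreserving_toMap⟩, ?_⟩
  have hlim : Tendsto (fun s : ℝ => ENNReal.ofReal (1 - s)) (𝓝[<] 1) (𝓝 0) := by
    have hc : Continuous fun s : ℝ => ENNReal.ofReal (1 - s) :=
      ENNReal.continuous_ofReal.comp (continuous_const.sub continuous_id)
    have := (hc.tendsto 1).mono_left (nhdsWithin_le_nhds (s := Iio 1))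
    rwa [sub_self, ENNReal.ofReal_zero] at this
  refine tendsto_of_tendsto_of_tendsto_of_le_of_le' tendsto_const_nhds hlim
    (Eventually.of_forall fun _ => zero_le) ?_
  filter_upwards [self_mem_nhdsWithin] with s hs
  exact (e s).metricEntropy_volume_le.trans (ENNReal.ofReal_le_ofReal (he s hs).le)

end CircleGibbs
end

theorem mainTheorem6 :
    -- the infimum over the Teichmüller space, in every degree
    (∀ d : ℕ, 2 ≤ d → IsGLB (CircleGibbs.geometricEntropies d) 0) ∧
    -- smooth expanding Lebesgue-preserving maps of degree two with entropy tending to zero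
    (∀ α : ℝ≥0, 0 < α → α ≤ 1 → ∃ f : ℝ → CircleGibbs.CircleEndo 2,
      (∀ s ∈ Ioo (0 : ℝ) 1, (f s).IsC1Holder α ∧ (f s).IsExpanding ∧
        MeasurePreserving (f s).toMap (volume : Measure UnitAddCircle) volume) ∧
      Tendsto (fun s => CircleGibbs.metricEntropy (f s).toMap (volume : Measure UnitAddCircle))
        (𝓝[<] 1) (𝓝 0)) ∧
    -- dual geometric Gibbs type measures are invariant, so that their entropy makes sense
    (∀ d : ℕ, 2 ≤ d → ∀ τ ∈ CircleGibbs.TUS d, ∀ Ψ, CircleGibbs.IsFunctionModel τ Ψ →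
      ∀ μ : Measure (CircleGibbs.DualSpace d), CircleGibbs.IsDualGeometricGibbs Ψ μ →
        MeasurePreserving CircleGibbs.dualShift μ μ) ∧
    -- the maximum and the infimum of their entropies
    (∀ d : ℕ, 2 ≤ d →
      IsGreatest (CircleGibbs.dualEntropies d) (ENNReal.ofReal (Real.log d)) ∧
      IsGLB (CircleGibbs.dualEntropies d) 0) :=
  ⟨CircleGibbs.isGLB_geometricEntropies,
    fun _ _ hα => CircleGibbs.exists_family_entropy_tendsto_zero hα,
    fun _ _ _ _ _ ⟨_, _, hp⟩ _ hμ => hμ.measurePreserving hp,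
    fun d hd => ⟨CircleGibbs.isGreatest_dualEntropies d hd, CircleGibbs.isGLB_dualEntropies d hd⟩⟩
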